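/- Let $n\ge 3$. Let $\mathcal{P}=\mathbb{C}[x_{ij}:1\le i\le n,\ 1\le j\le 3]$ be the algebra of polynomial functions on the space of complex $n\times 3$ matrices $X=(x_{ij})$, with the action of $\mathrm{GL}_n\times\mathrm{GL}_3$ given by $((g,h).f)(X)=f(g^{t}Xh)$. The symmetric group $\mathfrak{S}_3$ acts on $\mathcal{P}$ by the algebra automorphisms $\tau.x_{ij}=x_{i\tau(j)}$. For $m\ge 0$ let $\mathcal{Q}_m$ be the space of all $f\in\mathcal{P}$ with $\mathrm{diag}(t_1,t_2,t_3).f=(t_1t_2t_3)^m f$ for every diagonal matrix $\mathrm{diag}(t_1,t_2,t_3)\in\mathrm{GL}_3$, and let $\mathcal{Q}=\bigoplus_{m\ge 0}\mathcal{Q}_m$, a subalgebra of $\mathcal{P}$. Let $U_n\subset\mathrm{GL}_n$ be the group of upper triangular matrices with all diagonal entries equal to $1$, let $\mathcal{Q}^{U_n}$ be the algebra of $U_n$-invariants in $\mathcal{Q}$, and put \[ (\mathcal{Q}^{U_n})^{\mathfrak{S}_3}=\{f\in\mathcal{Q}^{U_n}:\tau.f=f\ \ \forall\tau\in\mathfrak{S}_3\},\qquad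 (\mathcal{Q}^{U_n})^{\mathrm{sgn}}=\{f\in\mathcal{Q}^{U_n}:\tau.f=\mathrm{sgn}(\tau)f\ \ \forall\tau\in\mathfrak{S}_3\}. \] Let $\delta_{ij}=x_{1i}x_{2j}-x_{1j}x_{2i}$ and \[ \alpha_1=x_{11}x_{12}x_{13},\quad \beta_2=x_{13}\delta_{12},\quad \beta_3=x_{12}\delta_{13},\quad \gamma_1=\det(x_{ij})_{1\le i,j\le 3},\quad \gamma_2=\delta_{12}\delta_{13}\delta_{23}, \] \[ \alpha_2=\beta_2^2+\beta_3^2-\beta_2\beta_3,\qquad \alpha_3=2(\beta_2^3+\beta_3^3)-3(\beta_2^2\beta_3+\beta_2\beta_3^2). \] (i) The algebra $(\mathcal{Q}^{U_n})^{\mathfrak{S}_3}$ is, as a complex vector space, spanned by the set \[ \mathbf{S}_{\mathrm{inv}}=\{\alpha_1^a\alpha_2^b\alpha_3^c(\gamma_1^2)^d(\gamma_2^2)^e(\gamma_1\gamma_2)^f : a,b,c,d,e,f\in\mathbb{Z}_{\ge 0}\}. \] Hence $\{\alpha_1,\alpha_2,\alpha_3,\gamma_1^2,\gamma_2^2,\gamma_1\gamma_2\}$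 is a set of algebra generators for $(\mathcal{Q}^{U_n})^{\mathfrak{S}_3}$. (ii) The space $(\mathcal{Q}^{U_n})^{\mathrm{sgn}}$ is spanned by the set \[ \begin{aligned} \mathbf{S}_{\mathrm{sgn}}&=\{\gamma_1h:h\in\mathbf{S}_{\mathrm{inv}}\}\cup\{\gamma_2h:h\in\mathbf{S}_{\mathrm{inv}}\}\\ &=\{\alpha_1^a\alpha_2^b\alpha_3^c\gamma_1^{2d+1}\gamma_2^{2e}:a,b,c,d,e\in\mathbb{Z}_{\ge 0}\}\cup\{\alpha_1^a\alpha_2^b\alpha_3^c\gamma_1^{2d}\gamma_2^{2e+1}:a,b,c,d,e\in\mathbb{Z}_{\ge 0}\}. \end{aligned} \] -/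

import Mathlib

open scoped BigOperators

noncomputable section

namespace Plethysm

/-- The algebra of polynomial functions on the space of `n × k` complex matrices, identified with
the polynomial algebra on the coordinate functions `x_{ij}`. -/
abbrev P (n k : ℕ) : Type := MvPolynomial (Fin n × Fin k) ℂ

/-- The substitution `X ↦ gᵗ X h` in polynomial functions on `n × k` matrices: the coordinate
function `x_{ij}` is sent to the `(i,j)` entry of `gᵗ X h`. -/
def subst {n k : ℕ} (g : Matrix (Fin n) (Fin n) ℂ) (h : Matrix (Fin k) (Fin k) ℂ) :
    P n k →ₐ[ℂ] P n k :=
  MvPolynomial.aeval fun ij : Fin n × Fin k =>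
    ∑ s : Fin n, ∑ t : Fin k,
      MvPolynomial.C (g s ij.1 * h t ij.2) * MvPolynomial.X (s, t)

/-- `subst g h f` is the polynomial function `X ↦ f (gᵗ X h)`. -/
theorem eval_subst {n k : ℕ} (g : Matrix (Fin n) (Fin n) ℂ) (h : Matrix (Fin k) (Fin k) ℂ)
    (f : P n k) (X : Matrix (Fin n) (Fin k) ℂ) :
    MvPolynomial.eval (fun ij => X ij.1 ij.2) (subst g h f) =
      MvPolynomial.eval (fun ij => (g.transpose * X * h) ij.1 ij.2) f := by
  induction f using MvPolynomial.induction_on with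
  | C a => simp [subst]
  | add p q hp hq => simp only [map_add, hp, hq]
  | mul_X p ij hp =>
    rw [map_mul, map_mul, map_mul, hp]
    congr 1
    simp only [subst, MvPolynomial.aeval_X, map_sum, map_mul, MvPolynomial.eval_C,
      MvPolynomial.eval_X, Matrix.mul_apply, Matrix.transpose_apply, Finset.sum_mul]
    rw [Finset.sum_comm]
    refine Finset.sum_congr rfl fun t _ => Finset.sum_congr rfl fun s _ => by ring

/-- Two polynomials agreeing at every matrix are equal. -/
theorem ext_eval {n k : ℕ} {f g : P n k}
    (h : ∀ X : Matrix (Fin n) (Fin k) ℂ,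
      MvPolynomial.eval (fun ij => X ij.1 ij.2) f =
        MvPolynomial.eval (fun ij => X ij.1 ij.2) g) : f = g :=
  MvPolynomial.funext fun x => h fun i j => x (i, j)

/-- The action of `GL_n × GL_k` on `P n k` by algebra homomorphisms,
`((g, h) . f) (X) = f (gᵗ X h)`. -/
def glAction (n k : ℕ) :
    Matrix.GeneralLinearGroup (Fin n) ℂ × Matrix.GeneralLinearGroup (Fin k) ℂ →*
      (P n k →ₐ[ℂ] P n k) where
  toFun gh := subst gh.1.val gh.2.val
  map_one' := by
    refine AlgHom.ext fun f => ext_eval fun X => ?_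
    simp [eval_subst]
  map_mul' a b := by
    refine AlgHom.ext fun f => ext_eval fun X => ?_
    simp [eval_subst, AlgHom.mul_apply, Matrix.mul_assoc, Matrix.transpose_mul]

/-- The action of the symmetric group on `P n k` by algebra homomorphisms,
`τ . x_{ij} = x_{i τ(j)}`. -/
def symAction (n k : ℕ) : Equiv.Perm (Fin k) →* (P n k →ₐ[ℂ] P n k) where
  toFun τ := MvPolynomial.rename fun ij : Fin n × Fin k => (ij.1, τ ij.2)
  map_one' := by
    ext x
    simp
  map_mul' a b := by
    ext x
    simp

/-- The action of `τ` is that of the permutation matrix `(δ_{i τ(j)})` in `GL_k`. -/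
theorem symAction_eq_subst {n k : ℕ} (τ : Equiv.Perm (Fin k)) :
    symAction n k τ =
      subst (1 : Matrix (Fin n) (Fin n) ℂ) (Matrix.of fun i j => if i = τ j then (1 : ℂ) else 0) := by
  refine MvPolynomial.algHom_ext fun ij => ?_
  rw [subst, MvPolynomial.aeval_X, Finset.sum_eq_single ij.1, Finset.sum_eq_single (τ ij.2)]
  · simp [symAction]
  · intro t _ ht
    simp [ht]
  · intro h
    exact absurd (Finset.mem_univ _) h
  · intro s _ hs
    simp [Matrix.one_apply, hs]
  · intro h
    exact absurd (Finset.mem_univ _) h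

/-- The diagonal matrix in `GL_k` with diagonal entries `t`. -/
def diagGL {k : ℕ} (t : Fin k → ℂˣ) : Matrix.GeneralLinearGroup (Fin k) ℂ where
  val := Matrix.diagonal fun j => (t j : ℂ)
  inv := Matrix.diagonal fun j => ((t j)⁻¹ : ℂˣ)
  val_inv := by simp
  inv_val := by simp

/-- The component `P_𝐦` of `P n k`: the polynomials on which the diagonal torus `A_k` of `GL_k`
acts by the character `diag(t₁, …, t_k) ↦ t₁^{m₁} ⋯ t_k^{m_k}`. -/
def weightSpace (n : ℕ) {k : ℕ} (m : Fin k → ℕ) : Submodule ℂ (P n k) where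
  carrier := {f | ∀ t : Fin k → ℂˣ,
    glAction n k (1, diagGL t) f = (∏ j, (t j : ℂ) ^ m j) • f}
  add_mem' := by
    intro a b ha hb t
    rw [map_add, ha t, hb t, smul_add]
  zero_mem' := by
    intro t
    rw [map_zero, smul_zero]
  smul_mem' := by
    intro c a ha t
    rw [map_smul, ha t, smul_comm]

theorem one_mem_weightSpace (n k : ℕ) : (1 : P n k) ∈ weightSpace n (fun _ : Fin k => 0) := by
  intro t
  simp

theorem mul_mem_weightSpace {n k : ℕ} {m m' : Fin k → ℕ} {a b : P n k}
    (ha : a ∈ weightSpace n m) (hb : b ∈ weightSpace n m') :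
    a * b ∈ weightSpace n (m + m') := by
  intro t
  rw [map_mul, ha t, hb t, smul_mul_smul_comm, ← Finset.prod_mul_distrib]
  simp only [Pi.add_apply, pow_add]

/-- `𝒬_m = P_{(m, …, m)}`. -/
def Qm (n k m : ℕ) : Submodule ℂ (P n k) := weightSpace n fun _ : Fin k => m

/-- The subalgebra `𝒬 = ⨁_m 𝒬_m` of `P n k` (the sum of the subspaces `𝒬_m`). -/
def Q (n k : ℕ) : Subalgebra ℂ (P n k) :=
  (⨆ m : ℕ, Qm n k m).toSubalgebra
    (Submodule.mem_iSup_of_mem 0 (one_mem_weightSpace n k))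
    (by
      intro a b ha hb
      induction ha using Submodule.iSup_induction' with
      | mem i x hx =>
        induction hb using Submodule.iSup_induction' with
        | mem j y hy =>
          exact Submodule.mem_iSup_of_mem (i + j) (mul_mem_weightSpace hx hy)
        | zero => rw [mul_zero]; exact Submodule.zero_mem _
        | add y z _ _ hy hz => rw [mul_add]; exact Submodule.add_mem _ hy hz
      | zero => rw [zero_mul]; exact Submodule.zero_mem _
      | add y z _ _ hy hz => rw [add_mul]; exact Submodule.add_mem _ hy hz)

/-- `U_n`: the upper triangular matrices in `GL_n` all of whose diagonal entries are `1`. -/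
def U (n : ℕ) : Subgroup (Matrix.GeneralLinearGroup (Fin n) ℂ) where
  carrier := {g | (∀ i j : Fin n, j < i → g.val i j = 0) ∧ ∀ i : Fin n, g.val i i = 1}
  one_mem' := by
    refine ⟨fun i j hij => ?_, fun i => ?_⟩
    · simp [hij.ne']
    · simp
  mul_mem' := by
    rintro a b ⟨ha, ha'⟩ ⟨hb, hb'⟩
    refine ⟨fun i j hij => ?_, fun i => ?_⟩
    · rw [Units.val_mul, Matrix.mul_apply]
      refine Finset.sum_eq_zero fun l _ => ?_
      rcases lt_or_ge l i with h | h
      · rw [ha i l h, zero_mul]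
      · rw [hb l j (lt_of_lt_of_le hij h), mul_zero]
    · rw [Units.val_mul, Matrix.mul_apply, Finset.sum_eq_single i]
      · rw [ha', hb', one_mul]
      · intro l _ hl
        rcases lt_or_gt_of_ne hl with h | h
        · rw [ha i l h, zero_mul]
        · rw [hb l i h, mul_zero]
      · intro h
        exact absurd (Finset.mem_univ i) h
  inv_mem' := by
    rintro a ⟨ha, ha'⟩
    have hT : Matrix.BlockTriangular a.val id := fun i j hij => ha i j hij
    have : Invertible a.val := a.invertible
    have hI : Matrix.BlockTriangular (a⁻¹).val id := by
      rw [Matrix.coe_units_inv]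
      exact Matrix.blockTriangular_inv_of_blockTriangular hT
    refine ⟨fun i j hij => hI hij, fun i => ?_⟩
    have h1 : (a.val * (a⁻¹).val) i i = 1 := by
      rw [a.mul_inv, Matrix.one_apply_eq]
    rw [Matrix.mul_apply, Finset.sum_eq_single i, ha', one_mul] at h1
    · exact h1
    · intro l _ hl
      rcases lt_or_gt_of_ne hl with h | h
      · rw [ha i l h, zero_mul]
      · rw [hI (show id i < id l from h), mul_zero]
    · intro h
      exact absurd (Finset.mem_univ i) h

/-- The algebra `𝒬^{U_n}` of `U_n`-invariants in `𝒬`. -/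
def QU (n k : ℕ) : Subalgebra ℂ (P n k) where
  carrier := {f | f ∈ Q n k ∧ ∀ u ∈ U n, glAction n k (u, 1) f = f}
  mul_mem' := by
    rintro a b ⟨ha, ha'⟩ ⟨hb, hb'⟩
    exact ⟨mul_mem ha hb, fun u hu => by rw [map_mul, ha' u hu, hb' u hu]⟩
  add_mem' := by
    rintro a b ⟨ha, ha'⟩ ⟨hb, hb'⟩
    exact ⟨add_mem ha hb, fun u hu => by rw [map_add, ha' u hu, hb' u hu]⟩
  algebraMap_mem' c := ⟨Subalgebra.algebraMap_mem _ c, fun _ _ => AlgHom.commutes _ c⟩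

/-- The algebra `(𝒬^{U_n})^{𝔖_k}` of `𝔖_k`-invariants in `𝒬^{U_n}`. -/
def QUinv (n k : ℕ) : Subalgebra ℂ (P n k) where
  carrier := {f | f ∈ QU n k ∧ ∀ τ : Equiv.Perm (Fin k), symAction n k τ f = f}
  mul_mem' := by
    rintro a b ⟨ha, ha'⟩ ⟨hb, hb'⟩
    exact ⟨mul_mem ha hb, fun τ => by rw [map_mul, ha' τ, hb' τ]⟩
  add_mem' := by
    rintro a b ⟨ha, ha'⟩ ⟨hb, hb'⟩
    exact ⟨add_mem ha hb, fun τ => by rw [map_add, ha' τ, hb' τ]⟩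
  algebraMap_mem' c := ⟨Subalgebra.algebraMap_mem _ c, fun _ => AlgHom.commutes _ c⟩

/-- The space `(𝒬^{U_n})^{sgn}` of the `f ∈ 𝒬^{U_n}` with `τ . f = sgn(τ) f` for all
`τ ∈ 𝔖_k`. -/
def QUsgn (n k : ℕ) : Submodule ℂ (P n k) where
  carrier := {f | f ∈ QU n k ∧ ∀ τ : Equiv.Perm (Fin k),
    symAction n k τ f = ((Equiv.Perm.sign τ : ℤ) : ℂ) • f}
  add_mem' := by
    rintro a b ⟨ha, ha'⟩ ⟨hb, hb'⟩
    exact ⟨add_mem ha hb, fun τ => by rw [map_add, ha' τ, hb' τ, smul_add]⟩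
  zero_mem' := ⟨zero_mem _, fun τ => by rw [map_zero, smul_zero]⟩
  smul_mem' := by
    rintro c a ⟨ha, ha'⟩
    exact ⟨Subalgebra.smul_mem _ ha c, fun τ => by rw [map_smul, ha' τ, smul_comm]⟩

section Three

variable {n : ℕ} (hn : 3 ≤ n)

/-- The coordinate function `x_{ij}`, for one of the first three rows `i` and a column `j`
(indices counted from `0`). -/
def x (i j : Fin 3) : P n 3 := MvPolynomial.X (Fin.castLE hn i, j)

/-- The `2 × 2` minor of the first two rows in the columns `i`, `j`. -/
def δ (i j : Fin 3) : P n 3 := Matrix.det !![x hn 0 i, x hn 0 j; x hn 1 i, x hn 1 j]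

/-- `α₁ = x₁₁ x₁₂ x₁₃`. -/
def α₁ : P n 3 := x hn 0 0 * x hn 0 1 * x hn 0 2

/-- `β₂ = x₁₃ δ₁₂`. -/
def β₂ : P n 3 := x hn 0 2 * δ hn 0 1

/-- `β₃ = x₁₂ δ₁₃`. -/
def β₃ : P n 3 := x hn 0 1 * δ hn 0 2

/-- `α₂ = β₂² + β₃² - β₂ β₃`. -/
def α₂ : P n 3 := β₂ hn ^ 2 + β₃ hn ^ 2 - β₂ hn * β₃ hn

/-- `α₃ = 2 (β₂³ + β₃³) - 3 (β₂² β₃ + β₂ β₃²)`. -/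
def α₃ : P n 3 :=
  2 * (β₂ hn ^ 3 + β₃ hn ^ 3) - 3 * (β₂ hn ^ 2 * β₃ hn + β₂ hn * β₃ hn ^ 2)

/-- `γ₁`, the determinant of the first three rows. -/
def γ₁ : P n 3 := Matrix.det (Matrix.of fun i j : Fin 3 => x hn i j)

/-- `γ₂ = δ₁₂ δ₁₃ δ₂₃`. -/
def γ₂ : P n 3 := δ hn 0 1 * δ hn 0 2 * δ hn 1 2

/-- The set of all monomials `α₁^a α₂^b α₃^c (γ₁²)^d (γ₂²)^e (γ₁γ₂)^f`. -/
def Sinv : Set (P n 3) :=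
  {p | ∃ a b c d e f : ℕ,
    p = α₁ hn ^ a * α₂ hn ^ b * α₃ hn ^ c * (γ₁ hn ^ 2) ^ d * (γ₂ hn ^ 2) ^ e *
      (γ₁ hn * γ₂ hn) ^ f}

/-- The set of all `γ₁ h` and all `γ₂ h` with `h` in `Sinv`. -/
def Ssgn : Set (P n 3) :=
  {p | ∃ h ∈ Sinv hn, p = γ₁ hn * h} ∪ {p | ∃ h ∈ Sinv hn, p = γ₂ hn * h}

end Three

end Plethysm

end

noncomputable section

namespace Plethysm

/-! Number rows and columns from 0. Over the fraction field, clear the rows below the third by `U n`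
and scale the columns so that the first row is (1,1,1). An invariant `f` of weight (m,m,m) is then
α₁^m times its value at second row `s` and third row `r`, the ratios of the second and third rows to
the first (`algebraMap_eq_rowEval`). Further row operations leave only the differences u = s₁ - s₀,
w = s₂ - s₀ and the determinant D, so f = α₁^m ∑ H_k(u,w) D^k with polynomial H_k
(`exists_expansion`). A permutation multiplies D by its sign. Hence each H_k is a
translation-invariant polynomial in three points of a line, symmetric or skew according to the
parity of k and the type of `f` (`IsExpansion.rename_coeff`). Since `f` has degree m in each column,
H_k has degree at most m - k in s₀ (`IsExpansion.degree_coeff`).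

It remains to describe such polynomials together with their degree in one point. The symmetric ones
are the polynomials in `A2` and `A3`, and the skew ones are `V` times these. The degrees of `A2`,
`A3`, `V` in one point are 2, 3, 2, but A3² - 4 A2³ = -27 V² has degree 4 instead of 6, so monomials
in `A2` and `A3` alone do not control the degree. Once powers of `V` are admitted they do: every
such polynomial is a combination of monomials A2^b A3^c V^e with 2b + 3c + 2e at most its own degree
(`mem_boundedSpan`).

At the slopes, `A2`, `A3`, `V`, D become α₂/α₁², α₃/α₁³, γ₂/α₁², γ₁/α₁. The degree bound therefore
says exactly that each term of `f` is a monomial in the generators with a nonnegative power of α₁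
(`exists_mem_paritySpan`). The parity of the total exponent of γ₁ and γ₂ separates invariants from
skew invariants. -/

theorem perm_fin_three_cases (τ : Equiv.Perm (Fin 3)) :
    (τ 0 = 0 ∧ τ 1 = 1 ∧ τ 2 = 2 ∧ Equiv.Perm.sign τ = 1) ∨
    (τ 0 = 1 ∧ τ 1 = 0 ∧ τ 2 = 2 ∧ Equiv.Perm.sign τ = -1) ∨
    (τ 0 = 0 ∧ τ 1 = 2 ∧ τ 2 = 1 ∧ Equiv.Perm.sign τ = -1) ∨
    (τ 0 = 2 ∧ τ 1 = 1 ∧ τ 2 = 0 ∧ Equiv.Perm.sign τ = -1) ∨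
    (τ 0 = 1 ∧ τ 1 = 2 ∧ τ 2 = 0 ∧ Equiv.Perm.sign τ = 1) ∨
    (τ 0 = 2 ∧ τ 1 = 0 ∧ τ 2 = 1 ∧ Equiv.Perm.sign τ = 1) := by
  revert τ; decide

/-! ### Weights, unipotent invariance and symmetry of the generators -/

section Generators
variable {n : ℕ} (hn : 3 ≤ n)

theorem δ_eq (i j : Fin 3) : δ hn i j = x hn 0 i * x hn 1 j - x hn 0 j * x hn 1 i := by
  simp [δ, Matrix.det_fin_two]

theorem γ₁_eq : γ₁ hn =
    x hn 0 0 * x hn 1 1 * x hn 2 2 - x hn 0 0 * x hn 1 2 * x hn 2 1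
      - x hn 0 1 * x hn 1 0 * x hn 2 2 + x hn 0 1 * x hn 1 2 * x hn 2 0
      + x hn 0 2 * x hn 1 0 * x hn 2 1 - x hn 0 2 * x hn 1 1 * x hn 2 0 := by
  simp [γ₁, Matrix.det_fin_three]

theorem symAction_x (τ : Equiv.Perm (Fin 3)) (i j : Fin 3) :
    symAction n 3 τ (x hn i j) = x hn i (τ j) := by
  simp [symAction, x]

theorem glAction_one_diagGL_x (t : Fin 3 → ℂˣ) (i j : Fin 3) :
    glAction n 3 (1, diagGL t) (x hn i j) = MvPolynomial.C (t j : ℂ) * x hn i j := by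
  simp only [glAction, subst, x, MonoidHom.coe_mk, OneHom.coe_mk, MvPolynomial.aeval_X]
  rw [Finset.sum_eq_single (Fin.castLE hn i), Finset.sum_eq_single j]
  · simp [diagGL]
  · intro b _ hb; simp [diagGL, hb]
  · simp
  · intro b _ hb; simp [hb]
  · simp

theorem glAction_one_right_X (u : Matrix.GeneralLinearGroup (Fin n) ℂ) (i : Fin n) (j : Fin 3) :
    glAction n 3 (u, 1) (MvPolynomial.X (i, j)) =
      ∑ s, MvPolynomial.C (u.val s i) * MvPolynomial.X (s, j) := by
  simp only [glAction, subst, MonoidHom.coe_mk, OneHom.coe_mk, MvPolynomial.aeval_X]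
  refine Finset.sum_congr rfl fun s _ => ?_
  rw [Finset.sum_eq_single j]
  · simp
  · intro b _ hb; simp [hb]
  · simp

theorem glAction_unipotent_x {u : Matrix.GeneralLinearGroup (Fin n) ℂ} (hu : u ∈ U n)
    (i j : Fin 3) :
    glAction n 3 (u, 1) (x hn i j) =
      ∑ s : Fin 3, MvPolynomial.C (u.val (Fin.castLE hn s) (Fin.castLE hn i)) * x hn s j := by
  rw [x, glAction_one_right_X]
  symm
  refine Finset.sum_of_injOn (Fin.castLE hn) (Fin.castLE_injective hn).injOn
    (fun _ _ => Finset.mem_coe.2 (Finset.mem_univ _)) ?_ (fun _ _ => rfl)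
  intro s _ hs
  have : Fin.castLE hn i < s := by
    by_contra h
    refine hs ⟨⟨s.1, ?_⟩, by simp, by ext; simp⟩
    have := Fin.le_def.1 (not_lt.1 h)
    have h3 := i.2
    simp at this
    omega
  rw [hu.1 _ _ this]; simp

theorem glAction_unipotent_x_zero {u : Matrix.GeneralLinearGroup (Fin n) ℂ} (hu : u ∈ U n)
    (j : Fin 3) : glAction n 3 (u, 1) (x hn 0 j) = x hn 0 j := by
  rw [glAction_unipotent_x hn hu, Fin.sum_univ_three, hu.2,
    hu.1 (Fin.castLE hn 1) _ (by simp [Fin.lt_def]), hu.1 (Fin.castLE hn 2) _ (by simp [Fin.lt_def])]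
  simp

theorem glAction_unipotent_x_one {u : Matrix.GeneralLinearGroup (Fin n) ℂ} (hu : u ∈ U n) :
    ∃ c : P n 3, ∀ j : Fin 3, glAction n 3 (u, 1) (x hn 1 j) = x hn 1 j + c * x hn 0 j := by
  refine ⟨MvPolynomial.C (u.val (Fin.castLE hn 0) (Fin.castLE hn 1)), fun j => ?_⟩
  rw [glAction_unipotent_x hn hu, Fin.sum_univ_three, hu.2,
    hu.1 (Fin.castLE hn 2) _ (by simp [Fin.lt_def])]
  simp [add_comm]

theorem glAction_unipotent_x_two {u : Matrix.GeneralLinearGroup (Fin n) ℂ} (hu : u ∈ U n) :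
    ∃ c d : P n 3, ∀ j : Fin 3,
      glAction n 3 (u, 1) (x hn 2 j) = x hn 2 j + c * x hn 0 j + d * x hn 1 j := by
  refine ⟨MvPolynomial.C (u.val (Fin.castLE hn 0) (Fin.castLE hn 2)),
    MvPolynomial.C (u.val (Fin.castLE hn 1) (Fin.castLE hn 2)), fun j => ?_⟩
  rw [glAction_unipotent_x hn hu, Fin.sum_univ_three, hu.2]
  simp; ring

theorem mem_Q_of_mem_Qm {k m : ℕ} {f : P n k} (hf : f ∈ Qm n k m) : f ∈ Q n k :=
  Submodule.mem_iSup_of_mem m hf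

theorem α₁_mem_Qm : α₁ hn ∈ Qm n 3 1 := by
  intro t
  simp only [α₁, map_mul, glAction_one_diagGL_x, MvPolynomial.smul_eq_C_mul, Fin.prod_univ_three]
  ring

theorem α₂_mem_Qm : α₂ hn ∈ Qm n 3 2 := by
  intro t
  simp only [α₂, β₂, β₃, δ_eq, map_mul, map_add, map_sub, map_pow, glAction_one_diagGL_x,
    MvPolynomial.smul_eq_C_mul, Fin.prod_univ_three]
  ring

theorem α₃_mem_Qm : α₃ hn ∈ Qm n 3 3 := by
  intro t
  simp only [α₃, β₂, β₃, δ_eq, map_mul, map_add, map_sub, map_pow, glAction_one_diagGL_x,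
    MvPolynomial.smul_eq_C_mul, Fin.prod_univ_three, map_ofNat]
  ring

theorem γ₁_mem_Qm : γ₁ hn ∈ Qm n 3 1 := by
  intro t
  simp only [γ₁_eq, map_mul, map_add, map_sub, glAction_one_diagGL_x,
    MvPolynomial.smul_eq_C_mul, Fin.prod_univ_three, map_pow]
  ring

theorem γ₂_mem_Qm : γ₂ hn ∈ Qm n 3 2 := by
  intro t
  simp only [γ₂, δ_eq, map_mul, map_sub, glAction_one_diagGL_x,
    MvPolynomial.smul_eq_C_mul, Fin.prod_univ_three, map_pow]
  ring

theorem glAction_unipotent_δ {u : Matrix.GeneralLinearGroup (Fin n) ℂ} (hu : u ∈ U n)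
    (i j : Fin 3) : glAction n 3 (u, 1) (δ hn i j) = δ hn i j := by
  obtain ⟨c, hc⟩ := glAction_unipotent_x_one hn hu
  simp only [δ_eq, map_sub, map_mul, glAction_unipotent_x_zero hn hu, hc]
  ring

theorem α₁_mem_QU : α₁ hn ∈ QU n 3 := by
  refine ⟨mem_Q_of_mem_Qm (α₁_mem_Qm hn), fun u hu => ?_⟩
  simp only [α₁, map_mul, glAction_unipotent_x_zero hn hu]

theorem α₂_mem_QU : α₂ hn ∈ QU n 3 := by
  refine ⟨mem_Q_of_mem_Qm (α₂_mem_Qm hn), fun u hu => ?_⟩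
  simp only [α₂, β₂, β₃, map_mul, map_add, map_sub, map_pow, glAction_unipotent_x_zero hn hu,
    glAction_unipotent_δ hn hu]

theorem α₃_mem_QU : α₃ hn ∈ QU n 3 := by
  refine ⟨mem_Q_of_mem_Qm (α₃_mem_Qm hn), fun u hu => ?_⟩
  simp only [α₃, β₂, β₃, map_mul, map_add, map_sub, map_pow, glAction_unipotent_x_zero hn hu,
    glAction_unipotent_δ hn hu, map_ofNat]

theorem γ₁_mem_QU : γ₁ hn ∈ QU n 3 := by
  refine ⟨mem_Q_of_mem_Qm (γ₁_mem_Qm hn), fun u hu => ?_⟩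
  obtain ⟨c, hc⟩ := glAction_unipotent_x_one hn hu
  obtain ⟨d, e, hd⟩ := glAction_unipotent_x_two hn hu
  simp only [γ₁_eq, map_mul, map_add, map_sub, glAction_unipotent_x_zero hn hu, hc, hd]
  ring

theorem γ₂_mem_QU : γ₂ hn ∈ QU n 3 := by
  refine ⟨mem_Q_of_mem_Qm (γ₂_mem_Qm hn), fun u hu => ?_⟩
  simp only [γ₂, map_mul, glAction_unipotent_δ hn hu]

theorem symAction_α₁ (τ : Equiv.Perm (Fin 3)) : symAction n 3 τ (α₁ hn) = α₁ hn := by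
  simp only [α₁, map_mul, symAction_x]
  rcases perm_fin_three_cases τ with ⟨h0, h1, h2, -⟩ | ⟨h0, h1, h2, -⟩ | ⟨h0, h1, h2, -⟩ |
    ⟨h0, h1, h2, -⟩ | ⟨h0, h1, h2, -⟩ | ⟨h0, h1, h2, -⟩ <;> rw [h0, h1, h2] <;> ring

theorem symAction_α₂ (τ : Equiv.Perm (Fin 3)) : symAction n 3 τ (α₂ hn) = α₂ hn := by
  simp only [α₂, β₂, β₃, δ_eq, map_mul, map_add, map_sub, map_pow, symAction_x]
  rcases perm_fin_three_cases τ with ⟨h0, h1, h2, -⟩ | ⟨h0, h1, h2, -⟩ | ⟨h0, h1, h2, -⟩ |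
    ⟨h0, h1, h2, -⟩ | ⟨h0, h1, h2, -⟩ | ⟨h0, h1, h2, -⟩ <;> rw [h0, h1, h2] <;> ring

theorem symAction_α₃ (τ : Equiv.Perm (Fin 3)) : symAction n 3 τ (α₃ hn) = α₃ hn := by
  simp only [α₃, β₂, β₃, δ_eq, map_mul, map_add, map_sub, map_pow, symAction_x, map_ofNat]
  rcases perm_fin_three_cases τ with ⟨h0, h1, h2, -⟩ | ⟨h0, h1, h2, -⟩ | ⟨h0, h1, h2, -⟩ |
    ⟨h0, h1, h2, -⟩ | ⟨h0, h1, h2, -⟩ | ⟨h0, h1, h2, -⟩ <;> rw [h0, h1, h2] <;> ring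

theorem symAction_γ₁ (τ : Equiv.Perm (Fin 3)) :
    symAction n 3 τ (γ₁ hn) = ((Equiv.Perm.sign τ : ℤ) : ℂ) • γ₁ hn := by
  simp only [γ₁_eq, map_mul, map_add, map_sub, symAction_x]
  rcases perm_fin_three_cases τ with ⟨h0, h1, h2, h⟩ | ⟨h0, h1, h2, h⟩ | ⟨h0, h1, h2, h⟩ |
    ⟨h0, h1, h2, h⟩ | ⟨h0, h1, h2, h⟩ | ⟨h0, h1, h2, h⟩ <;> rw [h0, h1, h2, h] <;> simp <;> ring

theorem symAction_γ₂ (τ : Equiv.Perm (Fin 3)) :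
    symAction n 3 τ (γ₂ hn) = ((Equiv.Perm.sign τ : ℤ) : ℂ) • γ₂ hn := by
  simp only [γ₂, δ_eq, map_mul, map_sub, symAction_x]
  rcases perm_fin_three_cases τ with ⟨h0, h1, h2, h⟩ | ⟨h0, h1, h2, h⟩ | ⟨h0, h1, h2, h⟩ |
    ⟨h0, h1, h2, h⟩ | ⟨h0, h1, h2, h⟩ | ⟨h0, h1, h2, h⟩ <;> rw [h0, h1, h2, h] <;> simp <;> ring

end Generators

/-! ### Translation-invariant polynomials in three points of a line -/

section DifferenceInvariants

/-- The quadratic form `u² + w² - u w`. -/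
def quadForm {R : Type*} [CommRing R] (u w : R) : R := u ^ 2 + w ^ 2 - u * w

/-- The cubic form `2 (u³ + w³) - 3 (u² w + u w²)`. -/
def cubicForm {R : Type*} [CommRing R] (u w : R) : R :=
  2 * (u ^ 3 + w ^ 3) - 3 * (u ^ 2 * w + u * w ^ 2)

/-- The product `u w (w - u)` of the differences of `0, u, w`. -/
def diffProd {R : Type*} [CommRing R] (u w : R) : R := u * w * (w - u)

/-- The discriminant identity for the cubic with roots 0, u, w, whose discriminant is the square of
`diffProd u w`. -/
theorem cubicForm_sq_sub {R : Type*} [CommRing R] (u w : R) :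
    cubicForm u w ^ 2 - 4 * quadForm u w ^ 3 = -27 * diffProd u w ^ 2 := by
  simp only [cubicForm, quadForm, diffProd]; ring

/-- Polynomial functions in three points of the line. -/
abbrev S3 : Type := MvPolynomial (Fin 3) ℂ

/-- `X₁ - X₀`. -/
def dU : S3 := MvPolynomial.X 1 - MvPolynomial.X 0
/-- `X₂ - X₀`. -/
def dW : S3 := MvPolynomial.X 2 - MvPolynomial.X 0
/-- `quadForm` in the differences of the variables. -/
def A2 : S3 := quadForm dU dW
/-- `cubicForm` in the differences of the variables. -/
def A3 : S3 := cubicForm dU dW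
/-- The Vandermonde product of the variables. -/
def V : S3 := diffProd dU dW

/-- Substitution of `A2` and `A3` into a polynomial in two variables. -/
def subA : Polynomial (Polynomial ℂ) →+* S3 :=
  Polynomial.eval₂RingHom (Polynomial.aeval (R := ℂ) A2).toRingHom A3

/-- The specialization `X₀ = η, X₁ = 0, X₂ = v` in `ℂ[v][η]`. -/
def spec : S3 →ₐ[ℂ] Polynomial (Polynomial ℂ) :=
  MvPolynomial.aeval ![Polynomial.X, 0, Polynomial.C Polynomial.X]

theorem spec_A2 : spec A2 = Polynomial.X ^ 2 - Polynomial.C Polynomial.X * Polynomial.X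
    + Polynomial.C (Polynomial.X ^ 2) := by
  simp [A2, quadForm, dU, dW, spec]; ring

theorem spec_A3 : spec A3 = 2 * Polynomial.X ^ 3
    - Polynomial.C (3 * Polynomial.X) * Polynomial.X ^ 2
    - Polynomial.C (3 * Polynomial.X ^ 2) * Polynomial.X + Polynomial.C (2 * Polynomial.X ^ 3) := by
  have h2 : Polynomial.C (2 : Polynomial ℂ) = 2 := map_ofNat _ 2
  have h3 : Polynomial.C (3 : Polynomial ℂ) = 3 := map_ofNat _ 3
  simp [A3, cubicForm, dU, dW, spec, h2, h3]; ring

theorem spec_V : spec V = Polynomial.C Polynomial.X * Polynomial.X ^ 2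
    - Polynomial.C (Polynomial.X ^ 2) * Polynomial.X := by
  simp [V, diffProd, dU, dW, spec]; ring

theorem degree_spec_A2 : (spec A2).degree = 2 := by
  rw [spec_A2]; compute_degree!

theorem degree_spec_A3 : (spec A3).degree = 3 := by
  rw [spec_A3]; compute_degree!

theorem degree_spec_V : (spec V).degree = 2 := by
  rw [spec_V]; compute_degree!

theorem V_ne_zero : V ≠ 0 := by
  intro h
  have := degree_spec_V
  rw [h, map_zero, Polynomial.degree_zero] at this
  exact absurd this (by decide)

/-- The specialization `X₀ = η, X₁ = 0, X₂ = 0`. -/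
def spec₀ : S3 →ₐ[ℂ] Polynomial ℂ := MvPolynomial.aeval ![Polynomial.X, 0, 0]

theorem spec₀_eq (p : S3) : spec₀ p = (spec p).map (Polynomial.evalRingHom 0) := by
  have : (spec₀ : S3 →ₐ[ℂ] Polynomial ℂ).toRingHom =
      (Polynomial.mapRingHom (Polynomial.evalRingHom 0)).comp spec.toRingHom := by
    refine MvPolynomial.ringHom_ext (fun c => ?_) (fun i => ?_)
    · simp [spec, spec₀, Polynomial.algebraMap_apply]
    · fin_cases i <;> simp [spec, spec₀]
  exact congrArg (fun g => g p) this

theorem degree_spec₀_le (p : S3) : (spec₀ p).degree ≤ (spec p).degree := by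
  rw [spec₀_eq]; exact Polynomial.degree_map_le

/-- The span of the monomials `A2^b A3^c V^e` with `e ≡ j` mod `2` of degree at most `d` in one
of the variables. -/
def boundedSpan (j : ℕ) (d : WithBot ℕ) : Submodule ℂ S3 :=
  Submodule.span ℂ {p | ∃ b c e : ℕ, e % 2 = j % 2 ∧ ((2 * b + 3 * c + 2 * e : ℕ) : WithBot ℕ) ≤ d ∧
    p = A2 ^ b * A3 ^ c * V ^ e}

/-- The degree in the outer variable η is the number of factors α₁ needed later to clear
denominators. `V` counts 2, not its total degree 3. -/
theorem degree_spec_monomial (b c e : ℕ) :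
    (spec (A2 ^ b * A3 ^ c * V ^ e)).degree = ((2 * b + 3 * c + 2 * e : ℕ) : WithBot ℕ) := by
  simp only [map_mul, map_pow, Polynomial.degree_mul, Polynomial.degree_pow, degree_spec_A2,
    degree_spec_A3, degree_spec_V]
  simp [mul_comm]

theorem degree_spec_le_of_mem_boundedSpan {j : ℕ} {d : WithBot ℕ} {p : S3}
    (hp : p ∈ boundedSpan j d) : (spec p).degree ≤ d := by
  induction hp using Submodule.span_induction with
  | mem p hp =>
    obtain ⟨b, c, e, -, h, rfl⟩ := hp
    rwa [degree_spec_monomial]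
  | zero => simp
  | add p q _ _ hp hq =>
    rw [map_add]; exact (Polynomial.degree_add_le _ _).trans (max_le hp hq)
  | smul a p _ hp =>
    rw [map_smul]; exact (Polynomial.degree_smul_le _ _).trans hp

theorem boundedSpan_mono {j : ℕ} {d d' : WithBot ℕ} (h : d ≤ d') :
    boundedSpan j d ≤ boundedSpan j d' :=
  Submodule.span_mono fun _ ⟨b, c, e, he, hd, hp⟩ => ⟨b, c, e, he, hd.trans h, hp⟩

theorem V_mul_mem_boundedSpan {j : ℕ} {d : WithBot ℕ} {p : S3} (hp : p ∈ boundedSpan j d) :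
    V * p ∈ boundedSpan (j + 1) (d + 2) := by
  induction hp using Submodule.span_induction with
  | mem p hp =>
    obtain ⟨b, c, e, he, h, rfl⟩ := hp
    refine Submodule.subset_span ⟨b, c, e + 1, by omega, ?_, by ring⟩
    have : ((2 * b + 3 * c + 2 * (e + 1) : ℕ) : WithBot ℕ) =
        ((2 * b + 3 * c + 2 * e : ℕ) : WithBot ℕ) + 2 := by
      rw [show 2 * b + 3 * c + 2 * (e + 1) = 2 * b + 3 * c + 2 * e + 2 by ring]; norm_cast
    rw [this]
    gcongr
  | zero => simp
  | add p q _ _ hp hq => rw [mul_add]; exact add_mem hp hq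
  | smul a p _ hp => rw [mul_smul_comm]; exact Submodule.smul_mem _ _ hp

/-- The discriminant relation, as a monic polynomial `Y² - 4 X³` in `Y`. -/
def discPoly : Polynomial (Polynomial ℂ) :=
  Polynomial.X ^ 2 - Polynomial.C (4 * Polynomial.X ^ 3)

theorem discPoly_monic : discPoly.Monic := by
  unfold discPoly; monicity!

theorem natDegree_discPoly : discPoly.natDegree = 2 := by
  unfold discPoly; compute_degree!

theorem subA_C (p : Polynomial ℂ) : subA (Polynomial.C p) = Polynomial.aeval A2 p := by
  simp [subA]

theorem subA_X : subA Polynomial.X = A3 := by simp [subA]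

theorem subA_discPoly : subA discPoly = -27 * V ^ 2 := by
  rw [discPoly, map_sub, map_pow, subA_X, subA_C]
  simp only [map_mul, map_pow, Polynomial.aeval_X, map_ofNat]
  exact cubicForm_sq_sub dU dW

/-- Division by the monic quadratic `discPoly` leaves a remainder f + gY, and `discPoly` itself
becomes -27 V² under `subA`. -/
theorem exists_subA_eq (F : Polynomial (Polynomial ℂ)) :
    ∃ f g : Polynomial ℂ, subA F = Polynomial.aeval A2 f + A3 * Polynomial.aeval A2 g
      + -27 * V ^ 2 * subA (F /ₘ discPoly) := by
  have hlt : (F %ₘ discPoly).natDegree ≤ 1 := by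
    have h := Polynomial.natDegree_modByMonic_lt F discPoly_monic
      (by intro h; simpa [h] using natDegree_discPoly)
    rw [natDegree_discPoly] at h
    omega
  obtain ⟨g, f, h⟩ := Polynomial.exists_eq_X_add_C_of_natDegree_le_one hlt
  refine ⟨f, g, ?_⟩
  conv_lhs => rw [← Polynomial.modByMonic_add_div F discPoly, h]
  simp only [map_add, map_mul, subA_C, subA_X, subA_discPoly]
  ring

theorem spec₀_A2 : spec₀ A2 = Polynomial.X ^ 2 := by
  simp [A2, quadForm, dU, dW, spec₀]; ring

theorem spec₀_A3 : spec₀ A3 = 2 * Polynomial.X ^ 3 := by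
  simp [A3, cubicForm, dU, dW, spec₀]; ring

theorem spec₀_V : spec₀ V = 0 := by
  simp [V, diffProd, dU, dW, spec₀]

/-- When two of the points coincide, `A2` and `A3` become η² and 2η³. The two summands then live in
even and odd powers of η, so their leading terms cannot cancel. -/
theorem spec₀_remainder (f g : Polynomial ℂ) :
    spec₀ (Polynomial.aeval A2 f + A3 * Polynomial.aeval A2 g) =
      Polynomial.expand ℂ 2 f + 2 * (Polynomial.expand ℂ 2 g * Polynomial.X ^ 3) := by
  rw [map_add, map_mul, ← Polynomial.aeval_algHom_apply, ← Polynomial.aeval_algHom_apply,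
    spec₀_A2, spec₀_A3]
  simp only [Polynomial.coe_expand, Polynomial.aeval_def, Polynomial.algebraMap_eq]
  ring

/-- By the parity separation, the coefficient of η^(2i) is the i-th coefficient of `f`, and that of
η^(2i+3) is twice the i-th coefficient of `g`. -/
theorem coeff_eq_zero_of_degree_remainder_lt {f g : Polynomial ℂ} {d : WithBot ℕ}
    (h : (spec₀ (Polynomial.aeval A2 f + A3 * Polynomial.aeval A2 g)).degree ≤ d) (i : ℕ) :
    (d < ((2 * i : ℕ) : WithBot ℕ) → f.coeff i = 0) ∧
      (d < ((2 * i + 3 : ℕ) : WithBot ℕ) → g.coeff i = 0) := by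
  rw [spec₀_remainder] at h
  have h2 : (2 : Polynomial ℂ) = Polynomial.C 2 := (map_ofNat _ 2).symm
  constructor
  · intro hi
    have := Polynomial.coeff_eq_zero_of_degree_lt (h.trans_lt hi)
    rw [Polynomial.coeff_add, Polynomial.coeff_expand_mul' two_pos, h2, Polynomial.coeff_C_mul,
      Polynomial.coeff_mul_X_pow'] at this
    split_ifs at this with h3
    · rwa [Polynomial.coeff_expand two_pos, if_neg (by omega), mul_zero, add_zero] at this
    · simpa using this
  · intro hi
    have := Polynomial.coeff_eq_zero_of_degree_lt (h.trans_lt hi)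
    rw [Polynomial.coeff_add, h2, Polynomial.coeff_C_mul, Polynomial.coeff_mul_X_pow,
      Polynomial.coeff_expand_mul' two_pos, Polynomial.coeff_expand two_pos, if_neg (by omega),
      zero_add] at this
    simpa using this

theorem remainder_mem_boundedSpan {f g : Polynomial ℂ} {d : WithBot ℕ}
    (h : (spec₀ (Polynomial.aeval A2 f + A3 * Polynomial.aeval A2 g)).degree ≤ d) :
    Polynomial.aeval A2 f + A3 * Polynomial.aeval A2 g ∈ boundedSpan 0 d := by
  rw [Polynomial.aeval_eq_sum_range, Polynomial.aeval_eq_sum_range, Finset.mul_sum]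
  refine add_mem (sum_mem fun i _ => ?_) (sum_mem fun i _ => ?_)
  · by_cases hi : d < ((2 * i : ℕ) : WithBot ℕ)
    · rw [(coeff_eq_zero_of_degree_remainder_lt h i).1 hi, zero_smul]
      exact zero_mem _
    · refine Submodule.smul_mem _ _ (Submodule.subset_span ⟨i, 0, 0, rfl, ?_, by ring⟩)
      simpa using hi
  · by_cases hi : d < ((2 * i + 3 : ℕ) : WithBot ℕ)
    · rw [(coeff_eq_zero_of_degree_remainder_lt h i).2 hi, zero_smul, mul_zero]
      exact zero_mem _
    · rw [mul_smul_comm]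
      refine Submodule.smul_mem _ _ (Submodule.subset_span ⟨i, 1, 0, rfl, ?_, by ring⟩)
      exact not_lt.1 hi

/-- Induction on the degree in Y. Each division by `discPoly` trades a cancelling combination of
`A2` and `A3` for V², whose degree in η is visible. -/
theorem subA_mem_boundedSpan (F : Polynomial (Polynomial ℂ)) :
    subA F ∈ boundedSpan 0 (spec (subA F)).degree := by
  induction hN : F.natDegree using Nat.strong_induction_on generalizing F with
  | _ N ih =>
    obtain ⟨f, g, h⟩ := exists_subA_eq F
    have hr : Polynomial.aeval A2 f + A3 * Polynomial.aeval A2 g ∈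
        boundedSpan 0 (spec (subA F)).degree := by
      -- `spec₀` kills `V`, so it sees only the remainder, and it does not raise the degree of the
      -- whole.
      refine remainder_mem_boundedSpan ?_
      have h0 : spec₀ (subA F) =
          spec₀ (Polynomial.aeval A2 f + A3 * Polynomial.aeval A2 g) := by
        rw [h]; simp [spec₀_V]
      rw [← h0]; exact degree_spec₀_le _
    by_cases hF : F.natDegree < 2
    · have h0 : F /ₘ discPoly = 0 := by
        rw [Polynomial.divByMonic_eq_zero_iff discPoly_monic]
        refine Polynomial.degree_lt_degree ?_
        rwa [natDegree_discPoly]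
      rw [h0, map_zero, mul_zero, add_zero] at h
      rwa [← h] at hr
    · have hq := ih _ (by rw [← hN, Polynomial.natDegree_divByMonic _ discPoly_monic,
        natDegree_discPoly]; omega) (F /ₘ discPoly) rfl
      set q := subA (F /ₘ discPoly) with hqdef
      have hVq : V * (V * q) ∈ boundedSpan 2 ((spec q).degree + 2 + 2) :=
        V_mul_mem_boundedSpan (V_mul_mem_boundedSpan hq)
      -- V² q is a multiple of the difference of the whole and the remainder, both within the bound.
      -- Degrees add over a domain, so `q` has degree at least 4 less.
      have hdeg : (spec q).degree + 2 + 2 ≤ (spec (subA F)).degree := by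
        have e1 : V * (V * q) = (-27⁻¹ : ℂ) • (subA F -
            (Polynomial.aeval A2 f + A3 * Polynomial.aeval A2 g)) := by
          rw [h, MvPolynomial.smul_eq_C_mul, add_sub_cancel_left,
            show -27 * V ^ 2 * q = MvPolynomial.C (-27) * (V * (V * q)) by
              rw [map_neg, map_ofNat]; ring, ← mul_assoc (MvPolynomial.C _), ← map_mul]
          norm_num
        have e2 : (spec (V * (V * q))).degree = (spec q).degree + 2 + 2 := by
          rw [map_mul, map_mul, Polynomial.degree_mul, Polynomial.degree_mul, degree_spec_V]
          abel
        rw [← e2, e1, map_smul, map_sub]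
        exact (Polynomial.degree_smul_le _ _).trans ((Polynomial.degree_sub_le _ _).trans
          (max_le le_rfl (degree_spec_le_of_mem_boundedSpan hr)))
      have hV2 : V * (V * q) ∈ boundedSpan 0 (spec (subA F)).degree := by
        have := boundedSpan_mono hdeg hVq
        simpa [boundedSpan] using this
      have key := add_mem hr (Submodule.smul_mem _ (-27 : ℂ) hV2)
      convert key using 1
      rw [h, MvPolynomial.smul_eq_C_mul, map_neg, map_ofNat]
      ring

/-- `V` vanishes where two points coincide, so the remainder modulo `discPoly` vanishes there and
hence is zero. Then V φ is a multiple of V², and one factor `V` cancels. -/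
theorem mem_boundedSpan_of_V_mul_eq_subA {φ : S3} {F : Polynomial (Polynomial ℂ)}
    (h : V * φ = subA F) : φ ∈ boundedSpan 1 (spec φ).degree := by
  obtain ⟨f, g, hF⟩ := exists_subA_eq F
  have h0 : spec₀ (Polynomial.aeval A2 f + A3 * Polynomial.aeval A2 g) = 0 := by
    have h1 : spec₀ (subA F) = 0 := by rw [← h, map_mul, spec₀_V, zero_mul]
    rw [hF, map_add, map_mul, map_mul, map_pow, spec₀_V] at h1
    simpa using h1
  have hr := remainder_mem_boundedSpan (f := f) (g := g) (d := ⊥) (by rw [h0]; simp)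
  have hr0 : Polynomial.aeval A2 f + A3 * Polynomial.aeval A2 g = 0 := by
    -- No monomial has degree at most `⊥`, so the generating set is empty.
    have he : boundedSpan 0 ⊥ = ⊥ := by
      rw [boundedSpan, Submodule.span_eq_bot]
      rintro p ⟨b, c, e, -, hd, -⟩
      exact absurd hd (not_le.2 (WithBot.bot_lt_coe _))
    rwa [he, Submodule.mem_bot] at hr
  rw [hr0, zero_add] at hF
  set q := subA (F /ₘ discPoly) with hq
  have hφ : φ = (-27 : ℂ) • (V * q) := by
    refine mul_left_cancel₀ V_ne_zero ?_
    rw [h, hF, MvPolynomial.smul_eq_C_mul, map_neg, map_ofNat]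
    ring
  have hd : (spec φ).degree = (spec q).degree + 2 := by
    rw [hφ, map_smul, Polynomial.degree_smul_of_smul_regular, map_mul, Polynomial.degree_mul,
      degree_spec_V, add_comm]
    exact IsSMulRegular.of_ne_zero (by norm_num)
  rw [hd, hφ]
  exact Submodule.smul_mem _ _ (V_mul_mem_boundedSpan (subA_mem_boundedSpan _))

theorem esymm_fin_three_one : MvPolynomial.esymm (Fin 3) ℂ 1 =
    MvPolynomial.X 0 + MvPolynomial.X 1 + MvPolynomial.X 2 := by
  rw [MvPolynomial.esymm_one, Fin.sum_univ_three]

theorem esymm_fin_three_two : MvPolynomial.esymm (Fin 3) ℂ 2 =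
    MvPolynomial.X 0 * MvPolynomial.X 1 + MvPolynomial.X 0 * MvPolynomial.X 2 +
      MvPolynomial.X 1 * MvPolynomial.X 2 := by
  rw [MvPolynomial.esymm, show Finset.powersetCard 2 (Finset.univ : Finset (Fin 3)) =
    {{0, 1}, {0, 2}, {1, 2}} by decide, Finset.sum_insert (by decide), Finset.sum_insert (by decide),
    Finset.sum_singleton, Finset.prod_pair (by decide), Finset.prod_pair (by decide),
    Finset.prod_pair (by decide), add_assoc]

theorem esymm_fin_three_three : MvPolynomial.esymm (Fin 3) ℂ 3 =
    MvPolynomial.X 0 * MvPolynomial.X 1 * MvPolynomial.X 2 := by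
  rw [MvPolynomial.esymm, show Finset.powersetCard 3 (Finset.univ : Finset (Fin 3)) =
    {Finset.univ} by decide, Finset.sum_singleton, Fin.prod_univ_three]

/-- Symmetric polynomials in differences are polynomials in `A2` and `A3`. -/
theorem exists_eq_subA_of_isSymmetric {φ : S3} (hs : φ.IsSymmetric)
    {H : MvPolynomial (Fin 2) ℂ} (hφ : φ = MvPolynomial.aeval ![dU, dW] H) :
    ∃ F, φ = subA F := by
  obtain ⟨p, hp⟩ := MvPolynomial.esymmAlgHom_surjective (σ := Fin 3) ℂ (n := 3) (by simp)
    ⟨φ, hs⟩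
  have hp' : φ = MvPolynomial.aeval (fun i : Fin 3 => MvPolynomial.esymm (Fin 3) ℂ (i + 1)) p := by
    have := congrArg Subtype.val hp
    rw [MvPolynomial.esymmAlgHom_apply] at this
    exact this.symm
  -- Translation by the mean of the points fixes polynomials in differences and makes the first
  -- elementary symmetric polynomial zero.
  let m : S3 := MvPolynomial.C (1 / 3) * (MvPolynomial.X 0 + MvPolynomial.X 1 + MvPolynomial.X 2)
  let θ : S3 →ₐ[ℂ] S3 := MvPolynomial.aeval fun i => MvPolynomial.X i - m
  have hθ : θ φ = φ := by
    have : θ.comp (MvPolynomial.aeval ![dU, dW]) = MvPolynomial.aeval ![dU, dW] := by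
      ext i : 1
      fin_cases i <;> simp [θ, dU, dW]
    rw [hφ]
    exact congrArg (fun g => g H) this
  -- For centred points the elementary symmetric polynomials are 0, -A2/3 and A3/27.
  let F : MvPolynomial (Fin 3) ℂ →ₐ[ℂ] Polynomial (Polynomial ℂ) :=
    MvPolynomial.aeval ![0, Polynomial.C (Polynomial.C (-1 / 3) * Polynomial.X),
      Polynomial.C (Polynomial.C (1 / 27)) * Polynomial.X]
  refine ⟨F p, ?_⟩
  have hcomp : subA.comp F.toRingHom = (θ.comp (MvPolynomial.aeval
      (fun i : Fin 3 => MvPolynomial.esymm (Fin 3) ℂ (i + 1)))).toRingHom := by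
    have h3 : (MvPolynomial.C (1 / 3 : ℂ) : S3) * 3 = 1 := by
      rw [← map_ofNat (MvPolynomial.C : ℂ →+* S3) 3, ← map_mul]; norm_num
    have h27 : (MvPolynomial.C (1 / 27 : ℂ) : S3) = MvPolynomial.C (1 / 3) ^ 3 := by
      rw [← map_pow]; norm_num
    have hneg : (MvPolynomial.C (-1 / 3 : ℂ) : S3) = -MvPolynomial.C (1 / 3) := by
      rw [← map_neg]; norm_num
    have hx : ∀ i, θ (MvPolynomial.X i) = MvPolynomial.X i - m := fun i => by simp [θ]
    have hC : ∀ c : ℂ, subA (Polynomial.C (Polynomial.C c)) = MvPolynomial.C c := fun c => by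
      rw [subA_C, Polynomial.aeval_C]; rfl
    refine MvPolynomial.ringHom_ext (fun c => ?_) (fun i => ?_)
    · simp [F, θ, Polynomial.algebraMap_apply, hC]
    · have h0 : subA (F (MvPolynomial.X 0)) = θ (MvPolynomial.esymm (Fin 3) ℂ 1) := by
        rw [esymm_fin_three_one, map_add, map_add, hx, hx, hx]
        simp only [F, MvPolynomial.aeval_X, Matrix.cons_val, map_zero, m]
        linear_combination (MvPolynomial.X 0 + MvPolynomial.X 1 + MvPolynomial.X 2) * h3
      have h1 : subA (F (MvPolynomial.X 1)) = θ (MvPolynomial.esymm (Fin 3) ℂ 2) := by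
        rw [esymm_fin_three_two]
        simp only [F, MvPolynomial.aeval_X, Matrix.cons_val, map_mul, map_add, hx, subA_C, hC,
          Polynomial.aeval_X, A2, quadForm, dU, dW, hneg, m]
        -- With 1/3 replaced by an indeterminate `a`, the identity holds modulo 3a = 1, with the
        -- explicit cofactor below.
        generalize (MvPolynomial.C (1 / 3) : S3) = a at *
        linear_combination (MvPolynomial.X 0 * MvPolynomial.X 1 +
          MvPolynomial.X 0 * MvPolynomial.X 2 + MvPolynomial.X 1 * MvPolynomial.X 2 -
          a * (MvPolynomial.X 0 + MvPolynomial.X 1 + MvPolynomial.X 2) ^ 2) * h3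
      have h2 : subA (F (MvPolynomial.X 2)) = θ (MvPolynomial.esymm (Fin 3) ℂ 3) := by
        rw [esymm_fin_three_three]
        simp only [F, MvPolynomial.aeval_X, Matrix.cons_val, map_mul, hx, subA_X, hC,
          A3, cubicForm, dU, dW, h27, m]
        generalize (MvPolynomial.C (1 / 3) : S3) = a at *
        linear_combination ((9 * a ^ 2 + 3 * a + 1) *
          (MvPolynomial.X 0 * MvPolynomial.X 1 * MvPolynomial.X 2) -
          a * (3 * a + 1) * (MvPolynomial.X 0 + MvPolynomial.X 1 + MvPolynomial.X 2) *
          (MvPolynomial.X 0 * MvPolynomial.X 1 +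
          MvPolynomial.X 0 * MvPolynomial.X 2 + MvPolynomial.X 1 * MvPolynomial.X 2) +
          a ^ 2 * (MvPolynomial.X 0 + MvPolynomial.X 1 + MvPolynomial.X 2) ^ 3) * h3
      have he : ∀ i : Fin 3, (θ.comp (MvPolynomial.aeval (fun i : Fin 3 =>
          MvPolynomial.esymm (Fin 3) ℂ (i + 1)))) (MvPolynomial.X i) =
          θ (MvPolynomial.esymm (Fin 3) ℂ (i + 1)) := fun i => by
        rw [AlgHom.comp_apply, MvPolynomial.aeval_X]
      refine Eq.trans ?_ (he i).symm
      fin_cases i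
      exacts [h0, h1, h2]
  calc φ = θ φ := hθ.symm
    _ = _ := by
      rw [hp']
      exact (congrArg (fun g => g p) hcomp).symm

theorem rename_V (τ : Equiv.Perm (Fin 3)) :
    MvPolynomial.rename τ V = ((Equiv.Perm.sign τ : ℤ) : ℂ) • V := by
  simp only [V, diffProd, dU, dW, map_mul, map_sub, MvPolynomial.rename_X]
  rcases perm_fin_three_cases τ with ⟨h0, h1, h2, h⟩ | ⟨h0, h1, h2, h⟩ | ⟨h0, h1, h2, h⟩ |
    ⟨h0, h1, h2, h⟩ | ⟨h0, h1, h2, h⟩ | ⟨h0, h1, h2, h⟩ <;> rw [h0, h1, h2, h] <;> simp <;> ring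

theorem sign_cast_sq (τ : Equiv.Perm (Fin 3)) :
    ((Equiv.Perm.sign τ : ℤ) : ℂ) * ((Equiv.Perm.sign τ : ℤ) : ℂ) = 1 := by
  rcases Int.units_eq_one_or (Equiv.Perm.sign τ) with h | h <;> simp [h]

/-- A polynomial in differences on which permutations act by the `j`-th power of the sign lies in
the span of the monomials of parity `j`, with control of the degree. -/
theorem mem_boundedSpan {φ : S3} {j : ℕ} {H : MvPolynomial (Fin 2) ℂ}
    (hφ : φ = MvPolynomial.aeval ![dU, dW] H)
    (hs : ∀ τ : Equiv.Perm (Fin 3),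
      MvPolynomial.rename τ φ = ((Equiv.Perm.sign τ : ℤ) : ℂ) ^ j • φ) :
    φ ∈ boundedSpan j (spec φ).degree := by
  have hpow : ∀ τ : Equiv.Perm (Fin 3), ((Equiv.Perm.sign τ : ℤ) : ℂ) ^ j =
      ((Equiv.Perm.sign τ : ℤ) : ℂ) ^ (j % 2) := fun τ => by
    conv_lhs => rw [← Nat.mod_add_div j 2, pow_add, pow_mul, sq, sign_cast_sq, one_pow, mul_one]
  have hj : boundedSpan j (spec φ).degree = boundedSpan (j % 2) (spec φ).degree := by
    simp [boundedSpan]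
  rw [hj]
  simp only [hpow] at hs
  rcases Nat.mod_two_eq_zero_or_one j with h | h <;> rw [h] at hs ⊢
  · obtain ⟨F, hF⟩ := exists_eq_subA_of_isSymmetric (fun τ => by simpa using hs τ) hφ
    rw [hF]
    exact subA_mem_boundedSpan F
  -- A skew polynomial becomes symmetric after multiplication by `V`, which is again a polynomial in
  -- differences.
  · obtain ⟨F, hF⟩ := exists_eq_subA_of_isSymmetric (φ := V * φ)
      (H := diffProd (MvPolynomial.X 0) (MvPolynomial.X 1) * H)
      (fun τ => by
        rw [map_mul, rename_V, hs, pow_one, smul_mul_smul_comm, sign_cast_sq, one_smul])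
      (by rw [map_mul, ← hφ]; simp [V, diffProd])
    exact mem_boundedSpan_of_V_mul_eq_subA hF

end DifferenceInvariants

/-! ### Row operations with coefficients in an arbitrary algebra -/

theorem sum_eq_sum_castLE {n : ℕ} {B : Type*} [AddCommMonoid B] (hn : 3 ≤ n) {g : Fin n → B} (hg : ∀ s : Fin n, 3 ≤ s.1 → g s = 0) :
    ∑ s, g s = ∑ s : Fin 3, g (Fin.castLE hn s) := by
  symm
  refine Finset.sum_of_injOn (Fin.castLE hn) (Fin.castLE_injective hn).injOn
    (fun _ _ => Finset.mem_coe.2 (Finset.mem_univ _)) ?_ (fun _ _ => rfl)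
  intro s _ hs
  refine hg s ?_
  by_contra h
  exact hs ⟨⟨s.1, by omega⟩, by simp, by ext; simp⟩

section RowOperations
variable {n : ℕ} {B : Type*} [CommRing B] [Algebra ℂ B]

/-- The unipotent matrix with the entries of `c` above the diagonal. -/
def unipotentMatrix (c : Fin n × Fin n → ℂ) : Matrix (Fin n) (Fin n) ℂ :=
  Matrix.of fun s i => if s < i then c (s, i) else if s = i then 1 else 0

theorem det_unipotentMatrix (c : Fin n × Fin n → ℂ) : (unipotentMatrix c).det = 1 := by
  rw [Matrix.det_of_isUpperTriangular]
  · simp [unipotentMatrix]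
  · intro i j hij
    have h : j < i := hij
    simp [unipotentMatrix, h.not_gt, h.ne']

/-- `unipotentMatrix` as an element of `GL_n`. -/
def unipotentGL (c : Fin n × Fin n → ℂ) : Matrix.GeneralLinearGroup (Fin n) ℂ :=
  Matrix.GeneralLinearGroup.mkOfDetNeZero (unipotentMatrix c)
    (by rw [det_unipotentMatrix]; exact one_ne_zero)

theorem unipotentGL_mem_U (c : Fin n × Fin n → ℂ) : unipotentGL c ∈ U n := by
  refine ⟨fun i j hij => ?_, fun i => ?_⟩
  · change unipotentMatrix c i j = 0
    simp [unipotentMatrix, hij.not_gt, hij.ne']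
  · change unipotentMatrix c i i = 1
    simp [unipotentMatrix]

theorem eval_add_rows {f : P n 3} (hf : ∀ u ∈ U n, glAction n 3 (u, 1) f = f)
    (c : Fin n × Fin n → ℂ) (X : Fin n → Fin 3 → ℂ) :
    MvPolynomial.eval (fun p => X p.1 p.2 + ∑ s, if s < p.1 then c (s, p.1) * X s p.2 else 0) f =
      MvPolynomial.eval (fun p => X p.1 p.2) f := by
  conv_rhs => rw [← hf _ (unipotentGL_mem_U c)]
  change _ = MvPolynomial.eval _ (subst (unipotentMatrix c) (1 : Matrix (Fin 3) (Fin 3) ℂ) f)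
  refine Eq.trans ?_ (eval_subst (unipotentMatrix c) 1 f (Matrix.of X)).symm
  rw [Matrix.mul_one]
  congr 2
  funext p
  rw [Matrix.mul_apply]
  symm
  refine (Finset.sum_congr rfl (g := fun s => (if s < p.1 then c (s, p.1) * X s p.2
    else 0) + if s = p.1 then X s p.2 else 0) ?_).trans ?_
  · intro s _
    rcases lt_trichotomy s p.1 with h | h | h
    · simp [unipotentMatrix, h, h.ne]
    · simp [unipotentMatrix, h]
    · simp [unipotentMatrix, h.not_gt, h.ne']
  · rw [Finset.sum_add_distrib, Finset.sum_ite_eq', if_pos (Finset.mem_univ _), add_comm]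

/-- Invariance under `U_n` implies invariance under row operations over any algebra. -/
theorem aeval_add_rows {f : P n 3} (hf : ∀ u ∈ U n, glAction n 3 (u, 1) f = f)
    (c : Fin n → Fin n → B) (X : Fin n → Fin 3 → B) :
    MvPolynomial.aeval (fun p => X p.1 p.2 + ∑ s, if s < p.1 then c s p.1 * X s p.2 else 0) f =
      MvPolynomial.aeval (fun p => X p.1 p.2) f := by
  -- The universal case: coefficients and entries are independent indeterminates. The identity may
  -- be tested at complex points, where invariance under `U n` applies, and then specializes to `B`.
  have key : MvPolynomial.aeval (R := ℂ) (S₁ := MvPolynomial ((Fin n × Fin n) ⊕ (Fin n × Fin 3)) ℂ)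
      (fun p => MvPolynomial.X (Sum.inr p) + ∑ s, if s < p.1 then
        MvPolynomial.X (Sum.inl (s, p.1)) * MvPolynomial.X (Sum.inr (s, p.2)) else 0) f =
      MvPolynomial.aeval (fun p => MvPolynomial.X (Sum.inr p)) f := by
    refine MvPolynomial.funext fun z => ?_
    rw [← MvPolynomial.coe_aeval_eq_eval]
    simp only [RingHom.coe_coe]
    rw [MvPolynomial.comp_aeval_apply, MvPolynomial.comp_aeval_apply]
    simp only [map_add, map_sum, apply_ite (MvPolynomial.aeval z), map_mul, map_zero,
      MvPolynomial.aeval_X]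
    exact eval_add_rows hf (fun q => z (Sum.inl q)) (fun i j => z (Sum.inr (i, j)))
  have h2 := congrArg (MvPolynomial.aeval (R := ℂ)
    (Sum.elim (fun q : Fin n × Fin n => c q.1 q.2) (fun p : Fin n × Fin 3 => X p.1 p.2))) key
  rw [MvPolynomial.comp_aeval_apply, MvPolynomial.comp_aeval_apply] at h2
  simpa only [map_add, map_sum, apply_ite (MvPolynomial.aeval (R := ℂ)
    (Sum.elim (fun q : Fin n × Fin n => c q.1 q.2) (fun p : Fin n × Fin 3 => X p.1 p.2))),
    map_mul, map_zero, MvPolynomial.aeval_X, Sum.elim_inl, Sum.elim_inr] using h2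

/-- The entries of the matrix with first rows `x, y, z` and all other rows zero. -/
def threeRows (n : ℕ) (x y z : Fin 3 → B) (p : Fin n × Fin 3) : B :=
  if h : p.1.1 < 3 then (![x, y, z] : Fin 3 → Fin 3 → B) ⟨p.1.1, h⟩ p.2 else 0

/-- Evaluation at the matrix with first rows `x, y, z` and all other rows zero. -/
def rowEval (n : ℕ) (x y z : Fin 3 → B) : P n 3 →ₐ[ℂ] B := MvPolynomial.aeval (threeRows n x y z)

theorem map_rowEval {B' : Type*} [CommRing B'] [Algebra ℂ B'] (g : B →ₐ[ℂ] B')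
    (x y z : Fin 3 → B) (f : P n 3) :
    g (rowEval n x y z f) =
      rowEval n (fun j => g (x j)) (fun j => g (y j)) (fun j => g (z j)) f := by
  rw [rowEval, rowEval, MvPolynomial.comp_aeval_apply]
  congr 2
  funext p
  rw [threeRows, threeRows]
  split_ifs with h
  · obtain ⟨⟨i, hi⟩, j⟩ := p
    dsimp only at h ⊢
    interval_cases i <;> rfl
  · exact map_zero g

theorem rowEval_add_rows (hn : 3 ≤ n) {f : P n 3} (hf : ∀ u ∈ U n, glAction n 3 (u, 1) f = f)
    (x y z : Fin 3 → B) (a b d : B) :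
    rowEval n x (fun j => y j + a * x j) (fun j => z j + b * x j + d * y j) f =
      rowEval n x y z f := by
  have h := aeval_add_rows hf (fun s i => if i.1 = 1 then a else if i.1 = 2 then
    (if s.1 = 0 then b else d) else 0) (fun i j => threeRows n x y z (i, j))
  refine Eq.trans ?_ h
  rw [rowEval]
  congr 2
  funext p
  rw [sum_eq_sum_castLE hn, Fin.sum_univ_three]
  · obtain ⟨⟨i, hi⟩, j⟩ := p
    by_cases h3 : i < 3
    · interval_cases i <;> simp [threeRows, Fin.lt_def] <;> ring
    · have h1 : i ≠ 1 := by omega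
      have h2 : i ≠ 2 := by omega
      simp [threeRows, h3, h1, h2]
  · intro s hs
    have : ¬ s.1 < 3 := by omega
    simp [threeRows, this]

/-- Over a field, a `U_n`-invariant depends only on the first three rows, if these are
independent. -/
theorem aeval_eq_rowEval {K : Type*} [Field K] [Algebra ℂ K] (hn : 3 ≤ n) {f : P n 3}
    (hf : ∀ u ∈ U n, glAction n 3 (u, 1) f = f) (X : Fin n → Fin 3 → K)
    (hX : (Matrix.of fun i j : Fin 3 => X (Fin.castLE hn i) j).det ≠ 0) :
    MvPolynomial.aeval (fun p => X p.1 p.2) f =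
      rowEval n (X (Fin.castLE hn 0)) (X (Fin.castLE hn 1)) (X (Fin.castLE hn 2)) f := by
  set T : Matrix (Fin 3) (Fin 3) K := Matrix.of fun i j : Fin 3 => X (Fin.castLE hn i) j with hT
  -- Each lower row is a combination of the first three rows, with coefficient vector X_i T⁻¹;
  -- subtracting it makes the row zero.
  have h := aeval_add_rows hf (fun s i => if h : s.1 < 3 then if 3 ≤ i.1 then
    -(Matrix.vecMul (X i) T⁻¹ ⟨s.1, h⟩) else 0 else 0) X
  rw [← h, rowEval]
  congr 2
  funext p
  rw [sum_eq_sum_castLE hn]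
  · obtain ⟨⟨i, hi⟩, j⟩ := p
    by_cases h3 : i < 3
    · interval_cases i <;> simp [threeRows] <;> rfl
    · have hle : 3 ≤ i := by omega
      have hlt : ∀ s : Fin 3, s.1 < i := fun s => by have := s.2; omega
      have hv : Matrix.vecMul (Matrix.vecMul (X ⟨i, hi⟩) T⁻¹) T j = X ⟨i, hi⟩ j := by
        rw [Matrix.vecMul_vecMul, Matrix.nonsing_inv_mul _ (isUnit_iff_ne_zero.2 hX),
          Matrix.vecMul_one]
      have hsum : ∑ s : Fin 3, Matrix.vecMul (X ⟨i, hi⟩) T⁻¹ s * X (Fin.castLE hn s) j =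
          X ⟨i, hi⟩ j := hv
      simp [threeRows, h3, hle, Fin.lt_def, hlt, hsum]
  · intro s hs
    have : ¬ s.1 < 3 := by omega
    simp [this]

theorem rowEval_perm {f : P n 3} {τ : Equiv.Perm (Fin 3)} {c : ℂ}
    (hf : symAction n 3 τ f = c • f) (x y z : Fin 3 → B) :
    rowEval n (fun j => x (τ j)) (fun j => y (τ j)) (fun j => z (τ j)) f =
      c • rowEval n x y z f := by
  rw [← map_smul, ← hf, symAction, rowEval, rowEval]
  simp only [MonoidHom.coe_mk, OneHom.coe_mk, MvPolynomial.aeval_rename]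
  congr 2
  funext p
  obtain ⟨⟨i, hi⟩, j⟩ := p
  simp only [threeRows, Function.comp]
  split_ifs with h
  · interval_cases i <;> rfl
  · rfl

end RowOperations

/-! ### Column weights and degrees -/

section Weights
variable {n : ℕ}

theorem coeff_aeval_C_mul_X {σ : Type*} [Fintype σ] (c : σ → ℂ) (f : MvPolynomial σ ℂ) (d : σ →₀ ℕ) :
    (MvPolynomial.aeval (fun p => MvPolynomial.C (c p) * MvPolynomial.X p) f).coeff d =
      (∏ p, c p ^ d p) * f.coeff d := by
  classical
  induction f using MvPolynomial.induction_on' with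
  | monomial u a =>
    rw [MvPolynomial.aeval_monomial, Finsupp.prod_fintype _ _ (fun _ => pow_zero _)]
    simp only [mul_pow, Finset.prod_mul_distrib, ← map_pow, ← map_prod]
    rw [← Finsupp.prod_fintype u (fun p k => (MvPolynomial.X p : MvPolynomial σ ℂ) ^ k)
      (fun _ => pow_zero _), MvPolynomial.algebraMap_eq, ← mul_assoc, ← map_mul,
      ← MvPolynomial.monomial_eq, MvPolynomial.coeff_monomial, MvPolynomial.coeff_monomial]
    split_ifs with h
    · rw [h, mul_comm]
    · rw [mul_zero]
  | add p q hp hq => rw [map_add, MvPolynomial.coeff_add, MvPolynomial.coeff_add, hp, hq, mul_add]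

theorem glAction_one_diagGL (t : Fin 3 → ℂˣ) (f : P n 3) :
    glAction n 3 (1, diagGL t) f =
      MvPolynomial.aeval (fun p => MvPolynomial.C (t p.2 : ℂ) * MvPolynomial.X p) f := by
  have : glAction n 3 (1, diagGL t) =
      MvPolynomial.aeval (fun p => MvPolynomial.C (t p.2 : ℂ) * MvPolynomial.X p) := by
    refine MvPolynomial.algHom_ext fun p => ?_
    simp only [glAction, subst, MonoidHom.coe_mk, OneHom.coe_mk, MvPolynomial.aeval_X]
    rw [Finset.sum_eq_single p.1, Finset.sum_eq_single p.2]
    · simp [diagGL]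
    · intro b _ hb; simp [diagGL, hb]
    · simp
    · intro b _ hb; simp [hb]
    · simp
  rw [this]

/-- Every monomial of an element of `Qm` has degree `m` in every column. -/
theorem sum_column_of_mem_support {m : ℕ} {f : P n 3} (hf : f ∈ Qm n 3 m)
    {d : Fin n × Fin 3 →₀ ℕ} (hd : d ∈ f.support) (j : Fin 3) : ∑ i, d (i, j) = m := by
  -- Scaling only column `j`, by 2, suffices because exponents of 2 are determined by the power.
  have h := congrArg (MvPolynomial.coeff d) (hf (Function.update 1 j (Units.mk0 2 two_ne_zero)))
  rw [glAction_one_diagGL, coeff_aeval_C_mul_X, MvPolynomial.coeff_smul, smul_eq_mul] at h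
  have h := mul_right_cancel₀ (MvPolynomial.mem_support_iff.1 hd) h
  rw [Fintype.prod_prod_type_right, Finset.prod_eq_single j, Finset.prod_eq_single j] at h
  · simp only [Function.update_self, Units.val_mk0] at h
    rw [Finset.prod_pow_eq_pow_sum] at h
    have h2 : (2 : ℕ) ^ (∑ i, d (i, j)) = 2 ^ m := by exact_mod_cast h
    exact Nat.pow_right_injective le_rfl h2
  · intro b _ hb; simp [hb]
  · simp
  · intro b _ hb; simp [hb]
  · simp

theorem rowEval_eq_sum {B : Type*} [CommRing B] [Algebra ℂ B] (x y z : Fin 3 → B) (f : P n 3) :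
    rowEval n x y z f =
      ∑ d ∈ f.support, algebraMap ℂ B (f.coeff d) * ∏ p, threeRows n x y z p ^ d p := by
  rw [rowEval, MvPolynomial.aeval_def, MvPolynomial.eval₂_eq']

theorem rowEval_scale {B : Type*} [CommRing B] [Algebra ℂ B] {m : ℕ} {f : P n 3}
    (hf : f ∈ Qm n 3 m) (t x y z : Fin 3 → B) :
    rowEval n (fun j => t j * x j) (fun j => t j * y j) (fun j => t j * z j) f =
      (t 0 * t 1 * t 2) ^ m * rowEval n x y z f := by
  rw [rowEval_eq_sum, rowEval_eq_sum, Finset.mul_sum]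
  refine Finset.sum_congr rfl fun d hd => ?_
  have h : ∀ p, threeRows n (fun j => t j * x j) (fun j => t j * y j) (fun j => t j * z j) p =
      t p.2 * threeRows n x y z p := by
    rintro ⟨⟨i, hi⟩, j⟩
    simp only [threeRows]
    split_ifs with h
    · interval_cases i <;> rfl
    · rw [mul_zero]
  simp only [h, mul_pow, Finset.prod_mul_distrib]
  have ht : ∏ p : Fin n × Fin 3, t p.2 ^ d p = t 0 ^ m * t 1 ^ m * t 2 ^ m := by
    rw [Fintype.prod_prod_type_right, Fin.prod_univ_three]
    simp only [Finset.prod_pow_eq_pow_sum, sum_column_of_mem_support hf hd]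
  rw [ht]; ring

/-- Joint degree at most `N` in the two outer variables of `ℂ[v][η][ζ]`. -/
def JointDegreeLE (N : ℕ) (p : Polynomial (Polynomial (Polynomial ℂ))) : Prop :=
  ∀ k l, N < k + l → (p.coeff k).coeff l = 0

theorem JointDegreeLE.mul {M N : ℕ} {p q : Polynomial (Polynomial (Polynomial ℂ))}
    (hp : JointDegreeLE M p) (hq : JointDegreeLE N q) : JointDegreeLE (M + N) (p * q) := by
  intro k l hkl
  rw [Polynomial.coeff_mul, Polynomial.finsetSum_coeff]
  refine Finset.sum_eq_zero fun a ha => ?_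
  rw [Polynomial.coeff_mul]
  refine Finset.sum_eq_zero fun b hb => ?_
  rw [Finset.HasAntidiagonal.mem_antidiagonal] at ha hb
  by_cases h : M < a.1 + b.1
  · rw [hp _ _ h, zero_mul]
  · rw [hq _ _ (by omega), mul_zero]

theorem JointDegreeLE.one : JointDegreeLE 0 1 := by
  intro k l h
  rw [Polynomial.coeff_one]
  split_ifs with hk
  · rw [Polynomial.coeff_one, if_neg (by omega)]
  · simp

theorem JointDegreeLE.pow {M : ℕ} {p : Polynomial (Polynomial (Polynomial ℂ))}
    (hp : JointDegreeLE M p) (e : ℕ) : JointDegreeLE (M * e) (p ^ e) := by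
  induction e with
  | zero => simpa using JointDegreeLE.one
  | succ e ih => rw [pow_succ, mul_add, mul_one]; exact ih.mul hp

theorem JointDegreeLE.prod {ι : Type*} (s : Finset ι) {M : ι → ℕ}
    {p : ι → Polynomial (Polynomial (Polynomial ℂ))} (hp : ∀ i, JointDegreeLE (M i) (p i)) :
    JointDegreeLE (∑ i ∈ s, M i) (∏ i ∈ s, p i) := by
  classical
  induction s using Finset.induction_on with
  | empty => simpa using JointDegreeLE.one
  | insert a s ha ih =>
    rw [Finset.sum_insert ha, Finset.prod_insert ha]; exact (hp a).mul ih

theorem JointDegreeLE.C_C (N : ℕ) (a : Polynomial ℂ) :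
    JointDegreeLE N (Polynomial.C (Polynomial.C a)) := by
  intro k l h
  rw [Polynomial.coeff_C]
  split_ifs with hk
  · rw [Polynomial.coeff_C, if_neg (by omega)]
  · simp

theorem JointDegreeLE.C_X : JointDegreeLE 1 (Polynomial.C Polynomial.X) := by
  intro k l h
  rw [Polynomial.coeff_C]
  split_ifs with hk
  · rw [Polynomial.coeff_X, if_neg (by omega)]
  · simp

theorem JointDegreeLE.X : JointDegreeLE 1 Polynomial.X := by
  intro k l h
  rw [Polynomial.coeff_X]
  split_ifs with hk
  · rw [Polynomial.coeff_one, if_neg (by omega)]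
  · simp

/-- The outer variables η and ζ occur only in column 0, where every monomial of `f` has degree m. -/
theorem jointDegreeLE_rowEval {m : ℕ} {f : P n 3} (hf : f ∈ Qm n 3 m) :
    JointDegreeLE m (rowEval n 1
      ![Polynomial.C Polynomial.X, 0, Polynomial.C (Polynomial.C Polynomial.X)]
      ![Polynomial.X, 0, 0] f) := by
  have h0 : ∀ N, JointDegreeLE N 0 := fun N => by simpa using JointDegreeLE.C_C N 0
  have h1 : ∀ N, JointDegreeLE N 1 := fun N => by simpa using JointDegreeLE.C_C N 1
  rw [rowEval_eq_sum]
  intro k l hkl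
  rw [Polynomial.finsetSum_coeff, Polynomial.finsetSum_coeff]
  refine Finset.sum_eq_zero fun d hd => ?_
  refine (zero_add m ▸ (JointDegreeLE.C_C 0 (Polynomial.C (f.coeff d))).mul
    (q := ∏ p, _ ^ d p) (N := m) ?_ : JointDegreeLE m _) k l hkl
  -- Entries of column 0 are counted with degree 1 and all others with degree 0.
  have hm : m = ∑ p : Fin n × Fin 3, (if p.2 = 0 then 1 else 0) * d p := by
    rw [Fintype.sum_prod_type_right, Fin.sum_univ_three]
    simp [sum_column_of_mem_support hf hd]
  rw [hm]
  refine JointDegreeLE.prod _ fun p => JointDegreeLE.pow ?_ _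
  obtain ⟨⟨i, hi⟩, j⟩ := p
  by_cases h : i < 3
  · simp only [threeRows, h, dite_true]
    interval_cases i <;> fin_cases j
    exacts [h1 _, h1 _, h1 _, JointDegreeLE.C_X, h0 _, JointDegreeLE.C_C 0 _,
      JointDegreeLE.X, h0 _, h0 _]
  · simp only [threeRows, h, dite_false]
    exact h0 _

end Weights

/-! ### Expansion in powers of the determinant -/

section Expansion
variable {n : ℕ} {f : P n 3}

theorem coeff_sum_C_mul_pow {R : Type*} [CommRing R] (a : ℕ → R) (b : R) {N k : ℕ} (hk : k < N) :
    (∑ i ∈ Finset.range N, Polynomial.C (a i) * (Polynomial.C b * Polynomial.X) ^ i).coeff k =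
      a k * b ^ k := by
  rw [Polynomial.finsetSum_coeff, Finset.sum_eq_single k]
  · rw [mul_pow, ← map_pow, ← mul_assoc, ← map_mul, Polynomial.coeff_C_mul_X_pow, if_pos rfl]
  · intro i _ hi
    rw [mul_pow, ← map_pow, ← mul_assoc, ← map_mul, Polynomial.coeff_C_mul_X_pow, if_neg hi.symm]
  · intro h; exact absurd (Finset.mem_range.2 hk) h

theorem exists_algHom_eq_eval₂ {A B : Type*} [CommRing A] [CommRing B] [Algebra ℂ A] [Algebra ℂ B]
    (φ : A →ₐ[ℂ] B) (t : B) :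
    ∃ g : Polynomial A →ₐ[ℂ] B, ∀ p, g p = Polynomial.eval₂ (φ : A →+* B) t p :=
  ⟨{ Polynomial.eval₂RingHom (φ : A →+* B) t with
      commutes' := fun c => by simp [Polynomial.algebraMap_apply] }, fun _ => rfl⟩

/-- The coefficients of an invariant at the matrix with rows `(1,1,1)`, `(0,u,v)`, `(0,0,w)`, as a
polynomial in `w`, are divisible by the powers of `u`. -/
theorem pow_dvd_coeff_rowEval (hn : 3 ≤ n) (hf : ∀ u ∈ U n, glAction n 3 (u, 1) f = f) (k : ℕ) :
    (MvPolynomial.X 0 : MvPolynomial (Fin 2) ℂ) ^ k ∣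
      (rowEval n 1 ![0, Polynomial.C (MvPolynomial.X 0 : MvPolynomial (Fin 2) ℂ),
        Polynomial.C (MvPolynomial.X 1)]
        ![0, 0, Polynomial.X] f).coeff k := by
  set u : MvPolynomial (Fin 2) ℂ := MvPolynomial.X 0 with hu
  set v : MvPolynomial (Fin 2) ℂ := MvPolynomial.X 1 with hv
  set G := rowEval n 1 ![0, Polynomial.C u, Polynomial.C v] ![0, 0, Polynomial.X] f with hG
  set G' := rowEval n 1 ![0, Polynomial.C u, Polynomial.C v] ![0, Polynomial.X, 0] f with hG'
  -- Adding X times the row (0,u,v) to (0,-uX,0) gives (0,0,vX). Comparing coefficients of X^k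
  -- yields v^k G_k = (-u)^k G'_k, and u is a prime not dividing v.
  have hcomp : G.comp (Polynomial.C v * Polynomial.X) = G'.comp (Polynomial.C (-u) * Polynomial.X) := by
    choose g hg using fun c : MvPolynomial (Fin 2) ℂ => exists_algHom_eq_eval₂
      (Algebra.ofId (MvPolynomial (Fin 2) ℂ) (Polynomial (MvPolynomial (Fin 2) ℂ)) |>.restrictScalars ℂ)
      (Polynomial.C c * Polynomial.X)
    have h1 : ∀ c p, p.comp (Polynomial.C c * Polynomial.X) = g c p := fun c p => (hg c p).symm
    have gC : ∀ c a, g c (Polynomial.C a) = Polynomial.C a := fun c a => by rw [← h1, Polynomial.C_comp]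
    have gX : ∀ c, g c Polynomial.X = Polynomial.C c * Polynomial.X := fun c => by
      rw [← h1, Polynomial.X_comp]
    rw [h1, h1, hG, hG', map_rowEval, map_rowEval]
    have e1 : ∀ c, (fun j : Fin 3 => g c (![0, Polynomial.C u, Polynomial.C v] j)) =
        ![0, Polynomial.C u, Polynomial.C v] := fun c => by
      funext j; fin_cases j <;> simp [gC]
    have e2 : ∀ c, (fun j : Fin 3 => g c ((1 : Fin 3 → _) j)) = 1 := fun c => by
      funext j; simp
    have e3 : (fun j : Fin 3 => g v (![0, 0, Polynomial.X] j)) =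
        ![0, 0, Polynomial.C v * Polynomial.X] := by
      funext j; fin_cases j <;> simp [gX]
    have e4 : (fun j : Fin 3 => g (-u) (![0, Polynomial.X, 0] j)) =
        ![0, Polynomial.C (-u) * Polynomial.X, 0] := by
      funext j; fin_cases j <;> simp [gX]
    rw [e1, e1, e2, e2, e3, e4, ← rowEval_add_rows hn hf 1 ![0, Polynomial.C u, Polynomial.C v]
      ![0, Polynomial.C (-u) * Polynomial.X, 0] 0 0 Polynomial.X]
    have e5 : (fun j : Fin 3 => ![0, Polynomial.C u, Polynomial.C v] j +
        (0 : Polynomial (MvPolynomial (Fin 2) ℂ)) * (1 : Fin 3 → _) j) =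
        ![0, Polynomial.C u, Polynomial.C v] := by
      funext j; rw [zero_mul, add_zero]
    have e6 : (fun j : Fin 3 => ![0, Polynomial.C (-u) * Polynomial.X, 0] j +
        (0 : Polynomial (MvPolynomial (Fin 2) ℂ)) * (1 : Fin 3 → _) j +
        Polynomial.X * ![0, Polynomial.C u, Polynomial.C v] j) =
        ![0, 0, Polynomial.C v * Polynomial.X] := by
      funext j
      fin_cases j
      · simp
      · simp; ring
      · simp
    rw [e5, e6]
  have hc := congrArg (fun p => p.coeff k) hcomp
  simp only [Polynomial.comp_C_mul_X_coeff] at hc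
  have hdvd : u ^ k ∣ v ^ k * G.coeff k := by
    rw [mul_comm, hc, neg_pow]
    exact ⟨(-1) ^ k * G'.coeff k, by ring⟩
  refine (MvPolynomial.X_prime : Prime u).pow_dvd_of_dvd_mul_left k (fun h => ?_) hdvd
  have := (MvPolynomial.X_prime : Prime u).dvd_of_dvd_pow h
  rw [hv, MvPolynomial.X_dvd_X] at this
  exact absurd this (by decide)

/-- A `U_n`-invariant at a matrix with first row `(1,1,1)` is a polynomial in the determinant with
coefficients polynomials in the differences of the entries of the second row. -/
theorem exists_expansion (hn : 3 ≤ n) (hf : ∀ u ∈ U n, glAction n 3 (u, 1) f = f) :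
    ∃ (N : ℕ) (H : ℕ → MvPolynomial (Fin 2) ℂ), ∀ (B : Type) [CommRing B] [IsDomain B]
      [Algebra ℂ B] (s r : Fin 3 → B), s 1 ≠ s 0 → rowEval n 1 s r f =
        ∑ k ∈ Finset.range N, MvPolynomial.aeval ![s 1 - s 0, s 2 - s 0] (H k) *
          ((s 1 - s 0) * (r 2 - r 0) - (s 2 - s 0) * (r 1 - r 0)) ^ k := by
  set G := rowEval n 1 ![0, Polynomial.C (MvPolynomial.X 0 : MvPolynomial (Fin 2) ℂ),
    Polynomial.C (MvPolynomial.X 1)] ![0, 0, Polynomial.X] f with hG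
  choose H hH using pow_dvd_coeff_rowEval hn hf
  have key : ∀ (K : Type) [Field K] [Algebra ℂ K] (s r : Fin 3 → K), s 1 ≠ s 0 →
      rowEval n 1 s r f = ∑ k ∈ Finset.range (G.natDegree + 1),
        MvPolynomial.aeval ![s 1 - s 0, s 2 - s 0] (H k) *
          ((s 1 - s 0) * (r 2 - r 0) - (s 2 - s 0) * (r 1 - r 0)) ^ k := by
    intro K _ _ s r hs
    have hU : s 1 - s 0 ≠ 0 := sub_ne_zero.2 hs
    set D := (s 1 - s 0) * (r 2 - r 0) - (s 2 - s 0) * (r 1 - r 0) with hD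
    let φ : MvPolynomial (Fin 2) ℂ →ₐ[ℂ] K := MvPolynomial.aeval ![s 1 - s 0, s 2 - s 0]
    obtain ⟨g, hg⟩ := exists_algHom_eq_eval₂ φ (D / (s 1 - s 0))
    have gC : ∀ a, g (Polynomial.C a) = φ a := fun a => by rw [hg, Polynomial.eval₂_C]; rfl
    have gX : g Polynomial.X = D / (s 1 - s 0) := by rw [hg, Polynomial.eval₂_X]
    have h1 : rowEval n 1 s r f = g G := by
      -- Gaussian elimination: these multipliers reduce the rows to (0, s₁-s₀, s₂-s₀) and (0, 0,
      -- D/(s₁-s₀)).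
      rw [hG, map_rowEval, ← rowEval_add_rows hn hf (1 : Fin 3 → K) s r (-s 0)
        (-r 0 + (r 1 - r 0) / (s 1 - s 0) * s 0) (-((r 1 - r 0) / (s 1 - s 0)))]
      have e0 : (fun j : Fin 3 => g ((1 : Fin 3 → _) j)) = 1 := by funext j; simp
      have e1 : (fun j : Fin 3 => g (![0, Polynomial.C (MvPolynomial.X 0),
          Polynomial.C (MvPolynomial.X 1)] j)) = fun j => s j + -s 0 * (1 : Fin 3 → K) j := by
        funext j
        fin_cases j
        · simp
        · simp [gC, φ]; ring
        · simp [gC, φ]; ring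
      have e2 : (fun j : Fin 3 => g (![0, 0, Polynomial.X] j)) = fun j => r j +
          (-r 0 + (r 1 - r 0) / (s 1 - s 0) * s 0) * (1 : Fin 3 → K) j +
          -((r 1 - r 0) / (s 1 - s 0)) * s j := by
        funext j
        fin_cases j
        · simp
        · simp; field_simp; ring
        · simp [gX, hD]; field_simp; ring
      rw [e0, e1, e2]
    rw [h1, hg, Polynomial.eval₂_eq_sum_range]
    refine Finset.sum_congr rfl fun k _ => ?_
    -- The divisibility by u^k cancels the denominator of (D/(s₁-s₀))^k, leaving a polynomial
    -- coefficient.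
    have h2 : (φ : MvPolynomial (Fin 2) ℂ →+* K) (G.coeff k) = (s 1 - s 0) ^ k * φ (H k) := by
      rw [hG, hH]
      change φ _ = _
      rw [map_mul, map_pow]
      simp [φ]
    rw [h2, div_pow]
    change _ = φ (H k) * _
    field_simp
  refine ⟨G.natDegree + 1, H, fun B _ _ _ s r hs => ?_⟩
  -- The final formula has no denominators, so it descends from the fraction field to the domain
  -- `B`.
  let j : B →ₐ[ℂ] FractionRing B := IsScalarTower.toAlgHom ℂ B (FractionRing B)
  have hj : Function.Injective j := IsFractionRing.injective B (FractionRing B)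
  apply hj
  rw [map_rowEval]
  have := key (FractionRing B) (fun i => j (s i)) (fun i => j (r i)) (fun h => hs (hj h))
  have h1 : (fun i : Fin 3 => j ((1 : Fin 3 → B) i)) = 1 := by funext i; simp
  rw [h1, this, map_sum]
  refine Finset.sum_congr rfl fun k _ => ?_
  rw [map_mul, map_pow, MvPolynomial.comp_aeval_apply]
  simp only [map_sub, map_mul]
  congr 3
  funext i
  fin_cases i <;> simp

end Expansion

/-! ### Symmetry and degree of the coefficients -/

section Coefficients
variable {n : ℕ} {f : P n 3} {N : ℕ} {H : ℕ → MvPolynomial (Fin 2) ℂ}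

/-- The expansion of `f` at matrices with first row `(1,1,1)` in powers of the determinant, with
coefficients given by `H`. -/
def IsExpansion (f : P n 3) (N : ℕ) (H : ℕ → MvPolynomial (Fin 2) ℂ) : Prop :=
  ∀ (B : Type) [CommRing B] [IsDomain B] [Algebra ℂ B] (s r : Fin 3 → B), s 1 ≠ s 0 →
    rowEval n 1 s r f =
      ∑ k ∈ Finset.range N, MvPolynomial.aeval ![s 1 - s 0, s 2 - s 0] (H k) *
        ((s 1 - s 0) * (r 2 - r 0) - (s 2 - s 0) * (r 1 - r 0)) ^ k

theorem algHom_aeval_pair {B B' : Type*} [CommRing B] [CommRing B'] [Algebra ℂ B] [Algebra ℂ B']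
    (g : B →ₐ[ℂ] B') (a b : B) (h : MvPolynomial (Fin 2) ℂ) :
    g (MvPolynomial.aeval ![a, b] h) = MvPolynomial.aeval ![g a, g b] h := by
  rw [MvPolynomial.comp_aeval_apply]
  congr 2
  funext i
  fin_cases i <;> rfl

theorem C_aeval_pair {A : Type*} [CommRing A] [Algebra ℂ A] (a b : A) (h : MvPolynomial (Fin 2) ℂ) :
    Polynomial.C (MvPolynomial.aeval ![a, b] h) =
      MvPolynomial.aeval ![Polynomial.C a, Polynomial.C b] h :=
  algHom_aeval_pair (Polynomial.CAlgHom (R := ℂ) (A := A)) a b h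

theorem dW_sub_dU_ne_zero : dW - dU ≠ 0 := by
  intro h
  refine V_ne_zero ?_
  rw [V, diffProd, h, mul_zero]

/-- The coefficients of the expansion inherit the symmetry, twisted by powers of the sign. -/
theorem IsExpansion.rename_coeff (hE : IsExpansion f N H) {i : ℕ}
    (hf : ∀ τ : Equiv.Perm (Fin 3), symAction n 3 τ f = ((Equiv.Perm.sign τ : ℤ) : ℂ) ^ i • f)
    {k : ℕ} (hk : k < N) (τ : Equiv.Perm (Fin 3)) :
    MvPolynomial.rename τ (MvPolynomial.aeval ![dU, dW] (H k)) =
      ((Equiv.Perm.sign τ : ℤ) : ℂ) ^ (i + k) • MvPolynomial.aeval ![dU, dW] (H k) := by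
  set ε : ℂ := ((Equiv.Perm.sign τ : ℤ) : ℂ) with hε
  let s : Fin 3 → Polynomial S3 := fun j => Polynomial.C (MvPolynomial.X j)
  -- With this third row the determinant is (dW - dU) times the new variable, so powers of that
  -- variable separate the coefficients H_k.
  let r : Fin 3 → Polynomial S3 := ![Polynomial.X, 0, 0]
  have hs : ∀ a b : Fin 3, a ≠ b → s a ≠ s b := fun a b hab h =>
    hab (MvPolynomial.X_injective (Polynomial.C_injective h))
  have h1 := hE _ s r (hs 1 0 (by decide))
  have h2 := hE _ (fun j => s (τ j)) (fun j => r (τ j))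
    (hs _ _ (fun h => absurd (τ.injective h) (by decide)))
  have h3 : rowEval n 1 (fun j => s (τ j)) (fun j => r (τ j)) f = ε ^ i • rowEval n 1 s r f :=
    rowEval_perm (hf τ) 1 s r
  have hD : (s 1 - s 0) * (r 2 - r 0) - (s 2 - s 0) * (r 1 - r 0) =
      Polynomial.C (dW - dU) * Polynomial.X := by
    simp [s, r, dU, dW]; ring
  have hDτ : (s (τ 1) - s (τ 0)) * (r (τ 2) - r (τ 0)) - (s (τ 2) - s (τ 0)) * (r (τ 1) - r (τ 0)) =
      Polynomial.C (MvPolynomial.C ε * (dW - dU)) * Polynomial.X := by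
    rw [hε]
    rcases perm_fin_three_cases τ with ⟨h0, h1, h2, h⟩ | ⟨h0, h1, h2, h⟩ | ⟨h0, h1, h2, h⟩ |
      ⟨h0, h1, h2, h⟩ | ⟨h0, h1, h2, h⟩ | ⟨h0, h1, h2, h⟩ <;> rw [h0, h1, h2, h] <;>
      simp [s, r, dU, dW] <;> ring
  have e1 : ∀ k, MvPolynomial.aeval ![s 1 - s 0, s 2 - s 0] (H k) =
      Polynomial.C (MvPolynomial.aeval ![dU, dW] (H k)) := fun k => by
    rw [C_aeval_pair]; simp [s, dU, dW]
  have e2 : ∀ k, MvPolynomial.aeval ![s (τ 1) - s (τ 0), s (τ 2) - s (τ 0)] (H k) =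
      Polynomial.C (MvPolynomial.rename τ (MvPolynomial.aeval ![dU, dW] (H k))) := fun k => by
    rw [algHom_aeval_pair, C_aeval_pair]; simp [s, dU, dW]
  simp only [hD, e1] at h1
  simp only [hDτ, e2] at h2
  rw [h2, h1] at h3
  have hc := congrArg (fun p => p.coeff k) h3
  simp only [Polynomial.coeff_smul] at hc
  rw [coeff_sum_C_mul_pow _ _ hk, coeff_sum_C_mul_pow _ _ hk, mul_pow, ← mul_assoc,
    ← smul_mul_assoc] at hc
  have hc := mul_right_cancel₀ (pow_ne_zero k dW_sub_dU_ne_zero) hc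
  have hεk : ε ^ k * ε ^ k = 1 := by rw [← mul_pow, hε, sign_cast_sq, one_pow]
  rw [← map_pow, mul_comm, ← MvPolynomial.smul_eq_C_mul] at hc
  rw [pow_add, mul_comm, mul_smul, ← hc, smul_smul, hεk, one_smul]

/-- At second row (η,0,v) and third row (ζ,0,0) the determinant is vζ, so the ζ^k-coefficient of the
expansion is v^k H_k, and the joint degree in η and ζ is at most m. Quantifying over `d` makes the
bound vacuous when H_k = 0, where k may exceed m. -/
theorem IsExpansion.degree_coeff (hE : IsExpansion f N H) {m : ℕ} (hf : f ∈ Qm n 3 m) {k : ℕ}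
    (hk : k < N) {d : ℕ} (hd : (d : WithBot ℕ) ≤
      (spec (MvPolynomial.aeval ![dU, dW] (H k))).degree) : d + k ≤ m := by
  set φ := MvPolynomial.aeval ![dU, dW] (H k) with hφ
  have hJ := jointDegreeLE_rowEval hf
  rw [hE _ _ _ (by
    simpa using (Polynomial.C_ne_zero.2 (Polynomial.X_ne_zero (R := Polynomial ℂ))).symm)] at hJ
  have hspec : ∀ k, MvPolynomial.aeval ![0 - Polynomial.C Polynomial.X,
      Polynomial.C (Polynomial.C Polynomial.X) - Polynomial.C Polynomial.X] (H k) =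
      Polynomial.C (spec (MvPolynomial.aeval ![dU, dW] (H k))) := fun k => by
    have hU : spec dU = 0 - Polynomial.X := by simp [spec, dU]
    have hW : spec dW = Polynomial.C Polynomial.X - Polynomial.X := by simp [spec, dW]
    rw [algHom_aeval_pair, C_aeval_pair, hU, hW, Polynomial.C_sub, Polynomial.C_sub,
      Polynomial.C_0]
  have hne : spec φ ≠ 0 := by
    intro h
    rw [h, Polynomial.degree_zero] at hd
    exact absurd hd (not_le.2 (WithBot.bot_lt_coe d))
  rw [Polynomial.degree_eq_natDegree hne] at hd
  have hd : d ≤ (spec φ).natDegree := by exact_mod_cast hd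
  by_contra hlt
  -- Beyond the joint degree the coefficient vanishes, but it equals the leading coefficient of
  -- `spec φ` times v^k.
  have h0 := hJ k (spec φ).natDegree (by omega)
  have hD : ((0 : Polynomial (Polynomial (Polynomial ℂ))) - Polynomial.C Polynomial.X) *
      (0 - Polynomial.X) - (Polynomial.C (Polynomial.C Polynomial.X) - Polynomial.C Polynomial.X) *
      (0 - Polynomial.X) = Polynomial.C (Polynomial.C Polynomial.X) * Polynomial.X := by ring
  simp only [Matrix.cons_val, hspec, hD] at h0
  rw [coeff_sum_C_mul_pow _ _ hk, ← map_pow, Polynomial.coeff_mul_C] at h0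
  rcases mul_eq_zero.1 h0 with h | h
  · exact hne (Polynomial.leadingCoeff_eq_zero.1 h)
  · exact pow_ne_zero k Polynomial.X_ne_zero h

end Coefficients

/-! ### Clearing denominators at the generic matrix -/

section Span
variable {n : ℕ} (hn : 3 ≤ n)

/-- The span of the monomials in the generators with `γ`-parity `i`. -/
def paritySpan (i : ℕ) : Submodule ℂ (P n 3) :=
  Submodule.span ℂ {p | ∃ a b c d e : ℕ, (d + e) % 2 = i % 2 ∧
    p = α₁ hn ^ a * α₂ hn ^ b * α₃ hn ^ c * γ₁ hn ^ d * γ₂ hn ^ e}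

theorem x_ne_zero (i j : Fin 3) : x hn i j ≠ 0 := MvPolynomial.X_ne_zero _

/-- The generic matrix over the field of fractions. -/
abbrev K (n : ℕ) : Type := FractionRing (P n 3)

/-- The generic entries as elements of the field of fractions. -/
def xK (i j : Fin 3) : K n := algebraMap (P n 3) (K n) (x hn i j)

theorem xK_ne_zero (i j : Fin 3) : xK hn i j ≠ 0 := by
  rw [xK, Ne, map_eq_zero_iff _ (IsFractionRing.injective (P n 3) (K n))]
  exact x_ne_zero hn i j

/-- The ratios of the second row to the first. -/
def slope (j : Fin 3) : K n := xK hn 1 j / xK hn 0 j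

/-- The ratios of the third row to the first. -/
def slope₂ (j : Fin 3) : K n := xK hn 2 j / xK hn 0 j

/-- The normalized determinant. -/
def normDet : K n :=
  (slope hn 1 - slope hn 0) * (slope₂ hn 2 - slope₂ hn 0) -
    (slope hn 2 - slope hn 0) * (slope₂ hn 1 - slope₂ hn 0)

theorem map_γ₁ : algebraMap (P n 3) (K n) (γ₁ hn) =
    algebraMap (P n 3) (K n) (α₁ hn) * normDet hn := by
  have h0 := xK_ne_zero hn 0 0
  have h1 := xK_ne_zero hn 0 1
  have h2 := xK_ne_zero hn 0 2
  simp only [γ₁_eq, α₁, normDet, slope, slope₂, map_add, map_sub, map_mul, ← xK.eq_def]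
  field_simp
  ring

theorem map_β₂ : algebraMap (P n 3) (K n) (β₂ hn) =
    algebraMap (P n 3) (K n) (α₁ hn) * (slope hn 1 - slope hn 0) := by
  have h0 := xK_ne_zero hn 0 0
  have h1 := xK_ne_zero hn 0 1
  simp only [β₂, δ_eq, α₁, slope, map_sub, map_mul, ← xK.eq_def]
  field_simp

theorem map_β₃ : algebraMap (P n 3) (K n) (β₃ hn) =
    algebraMap (P n 3) (K n) (α₁ hn) * (slope hn 2 - slope hn 0) := by
  have h0 := xK_ne_zero hn 0 0
  have h2 := xK_ne_zero hn 0 2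
  simp only [β₃, δ_eq, α₁, slope, map_sub, map_mul, ← xK.eq_def]
  field_simp

/-- Evaluation at the slopes. -/
def evSlope : S3 →ₐ[ℂ] K n := MvPolynomial.aeval (slope hn)

theorem evSlope_dU : evSlope hn dU = slope hn 1 - slope hn 0 := by simp [evSlope, dU]
theorem evSlope_dW : evSlope hn dW = slope hn 2 - slope hn 0 := by simp [evSlope, dW]

theorem map_α₂ : algebraMap (P n 3) (K n) (α₂ hn) =
    algebraMap (P n 3) (K n) (α₁ hn) ^ 2 * evSlope hn A2 := by
  simp only [α₂, A2, quadForm, map_add, map_sub, map_mul, map_pow, map_β₂, map_β₃, evSlope_dU,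
    evSlope_dW]
  ring

theorem map_α₃ : algebraMap (P n 3) (K n) (α₃ hn) =
    algebraMap (P n 3) (K n) (α₁ hn) ^ 3 * evSlope hn A3 := by
  simp only [α₃, A3, cubicForm, map_add, map_sub, map_mul, map_pow, map_β₂, map_β₃, evSlope_dU,
    evSlope_dW, map_ofNat]
  ring

theorem map_γ₂ : algebraMap (P n 3) (K n) (γ₂ hn) =
    algebraMap (P n 3) (K n) (α₁ hn) ^ 2 * evSlope hn V := by
  have h0 := xK_ne_zero hn 0 0
  have h1 := xK_ne_zero hn 0 1
  have h2 := xK_ne_zero hn 0 2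
  simp only [V, diffProd, map_mul, map_sub, evSlope_dU, evSlope_dW, γ₂, δ_eq, α₁, slope,
    ← xK.eq_def]
  field_simp
  ring

theorem normDet_ne_zero : normDet hn ≠ 0 := by
  intro h
  have h1 := map_γ₁ hn
  rw [h, mul_zero, map_eq_zero_iff _ (IsFractionRing.injective (P n 3) (K n))] at h1
  -- The first three rows form the identity matrix, where γ₁ is 1.
  let pt : Fin n × Fin 3 → ℂ := fun p => if p.1.1 = p.2.1 then 1 else 0
  have h2 := congrArg (MvPolynomial.eval pt) h1
  rw [γ₁_eq] at h2
  simp [x, pt] at h2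

theorem slope_one_ne_slope_zero : slope hn 1 ≠ slope hn 0 := by
  intro h
  have h1 := map_β₂ hn
  rw [h, sub_self, mul_zero, map_eq_zero_iff _ (IsFractionRing.injective (P n 3) (K n))] at h1
  -- The first two rows are (1,0,1) and (1,1,1), where β₂ is 1.
  let pt : Fin n × Fin 3 → ℂ := fun p => if p.1.1 = 0 ∧ p.2 ≠ 1 ∨ p.1.1 = 1 then 1 else 0
  have h2 := congrArg (MvPolynomial.eval pt) h1
  rw [β₂, δ_eq] at h2
  simp [x, pt] at h2

/-- A monomial in the slopes of bounded degree becomes polynomial after multiplication by a power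
of `α₁`. -/
theorem exists_mem_paritySpan {m k j : ℕ} {ψ : S3} {D : WithBot ℕ}
    (hψ : ψ ∈ boundedSpan j D) (hD : ∀ d : ℕ, (d : WithBot ℕ) ≤ D → d + k ≤ m) :
    ∃ p ∈ paritySpan hn (k + j), algebraMap (P n 3) (K n) p =
      algebraMap (P n 3) (K n) (α₁ hn) ^ m * (evSlope hn ψ * normDet hn ^ k) := by
  induction hψ using Submodule.span_induction with
  | mem p hp =>
    obtain ⟨b, c, e, he, hd, rfl⟩ := hp
    -- The exponent of α₁ is what remains of m after the denominators of A2^b A3^c V^e and of the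
    -- k-th power of the determinant are cleared.
    obtain ⟨a, ha⟩ := Nat.exists_eq_add_of_le (hD _ hd)
    refine ⟨_, Submodule.subset_span ⟨a, b, c, k, e, by omega, rfl⟩, ?_⟩
    simp only [map_mul, map_pow, map_α₂, map_α₃, map_γ₁, map_γ₂]
    rw [ha]
    ring
  | zero => exact ⟨0, zero_mem _, by simp⟩
  | add p q _ _ hp hq =>
    obtain ⟨p', hp', hp⟩ := hp
    obtain ⟨q', hq', hq⟩ := hq
    exact ⟨p' + q', add_mem hp' hq', by rw [map_add, hp, hq, map_add]; ring⟩
  | smul c p _ hp =>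
    obtain ⟨p', hp', hp⟩ := hp
    refine ⟨c • p', Submodule.smul_mem _ _ hp', ?_⟩
    rw [Algebra.smul_def c p', map_mul, hp, ← IsScalarTower.algebraMap_apply,
      map_smul (evSlope hn), Algebra.smul_def c (evSlope hn p)]
    ring

/-- Every `U_n`-invariant of weight `(m,m,m)` is determined by its expansion at the slopes. -/
theorem algebraMap_eq_rowEval {m : ℕ} {f : P n 3} (hU : ∀ u ∈ U n, glAction n 3 (u, 1) f = f)
    (hQ : f ∈ Qm n 3 m) : algebraMap (P n 3) (K n) f =
      algebraMap (P n 3) (K n) (α₁ hn) ^ m * rowEval n 1 (slope hn) (slope₂ hn) f := by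
  have hgen : algebraMap (P n 3) (K n) f = MvPolynomial.aeval
      (fun p : Fin n × Fin 3 => algebraMap (P n 3) (K n) (MvPolynomial.X (p.1, p.2))) f := by
    have := MvPolynomial.comp_aeval_apply (R := ℂ) (MvPolynomial.X : Fin n × Fin 3 → P n 3)
      (IsScalarTower.toAlgHom ℂ (P n 3) (K n)) f
    rw [MvPolynomial.aeval_X_left_apply] at this
    exact this
  have h0 := xK_ne_zero hn 0 0
  have h1 := xK_ne_zero hn 0 1
  have h2 := xK_ne_zero hn 0 2
  have hdet : (Matrix.of fun i j : Fin 3 => algebraMap (P n 3) (K n)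
      (MvPolynomial.X (Fin.castLE hn i, j))).det ≠ 0 := by
    have : (Matrix.of fun i j : Fin 3 => algebraMap (P n 3) (K n)
      (MvPolynomial.X (Fin.castLE hn i, j))).det = algebraMap (P n 3) (K n) (γ₁ hn) := by
      rw [γ₁, RingHom.map_det]; rfl
    rw [this, map_γ₁]
    refine mul_ne_zero ?_ (normDet_ne_zero hn)
    simp only [α₁, map_mul]
    exact mul_ne_zero (mul_ne_zero h0 h1) h2
  rw [hgen, aeval_eq_rowEval hn hU
    (fun i j => algebraMap (P n 3) (K n) (MvPolynomial.X (i, j))) hdet]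
  have hscale := rowEval_scale hQ (xK hn 0) 1 (slope hn) (slope₂ hn)
  have e0 : (fun j => xK hn 0 j * (1 : Fin 3 → K n) j) = xK hn 0 := by funext j; simp
  have e1 : (fun j => xK hn 0 j * slope hn j) = xK hn 1 := by
    funext j; rw [slope, mul_div_cancel₀ _ (xK_ne_zero hn 0 j)]
  have e2 : (fun j => xK hn 0 j * slope₂ hn j) = xK hn 2 := by
    funext j; rw [slope₂, mul_div_cancel₀ _ (xK_ne_zero hn 0 j)]
  rw [e0, e1, e2] at hscale
  simp only [α₁, map_mul]
  exact hscale

/-- The homogeneous invariants and skew invariants lie in the span of the monomials. -/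
theorem mem_paritySpan_of_mem_Qm {m i : ℕ} {f : P n 3}
    (hU : ∀ u ∈ U n, glAction n 3 (u, 1) f = f) (hQ : f ∈ Qm n 3 m)
    (hS : ∀ τ : Equiv.Perm (Fin 3), symAction n 3 τ f = ((Equiv.Perm.sign τ : ℤ) : ℂ) ^ i • f) :
    f ∈ paritySpan hn i := by
  obtain ⟨N, H, hE⟩ := exists_expansion hn hU
  have hE : IsExpansion f N H := hE
  have hk : ∀ k ∈ Finset.range N, ∃ p ∈ paritySpan hn i, algebraMap (P n 3) (K n) p =
      algebraMap (P n 3) (K n) (α₁ hn) ^ m *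
        (evSlope hn (MvPolynomial.aeval ![dU, dW] (H k)) * normDet hn ^ k) := by
    intro k hk
    rw [Finset.mem_range] at hk
    have hb := mem_boundedSpan rfl (hE.rename_coeff hS hk)
    have := exists_mem_paritySpan hn hb (fun d hd => hE.degree_coeff hQ hk hd)
    -- The sign twist i + k of the coefficient and the k factors γ₁ combine to parity i.
    have hpar : paritySpan hn (k + (i + k)) = paritySpan hn i := by
      rw [paritySpan, paritySpan, show (k + (i + k)) % 2 = i % 2 by omega]
    rwa [hpar] at this
  choose! p hp hpe using hk
  have hf : f = ∑ k ∈ Finset.range N, p k := by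
    apply IsFractionRing.injective (P n 3) (K n)
    rw [algebraMap_eq_rowEval hn hU hQ, hE _ _ _ (slope_one_ne_slope_zero hn), map_sum, Finset.mul_sum]
    refine Finset.sum_congr rfl fun k hk => ?_
    rw [hpe k hk, algHom_aeval_pair, evSlope_dU, evSlope_dW, normDet]
  rw [hf]
  exact sum_mem hp

end Span

/-! ### Reduction to a single weight -/

section Components
variable {n : ℕ}

/-- The spaces `Qm n 3 m` lie in distinct total degrees 3m. Projections onto weights are thus
homogeneous components, which commute with linear substitutions and so preserve all the invariance
conditions. -/
theorem isHomogeneous_of_mem_Qm {m : ℕ} {f : P n 3} (hf : f ∈ Qm n 3 m) :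
    f.IsHomogeneous (3 * m) := by
  intro d hd
  have hs := sum_column_of_mem_support hf (MvPolynomial.mem_support_iff.2 hd)
  refine Eq.trans (b := d.degree) (by rw [Finsupp.degree_eq_weight_one]; rfl) ?_
  rw [Finsupp.degree_eq_sum, Fintype.sum_prod_type_right, Fin.sum_univ_three, hs, hs, hs]
  ring

theorem isHomogeneous_subst {k : ℕ} (g : Matrix (Fin n) (Fin n) ℂ) (h : Matrix (Fin k) (Fin k) ℂ)
    {f : P n k} {d : ℕ} (hf : f.IsHomogeneous d) : (subst g h f).IsHomogeneous d := by
  have := hf.aeval (n := 1) (fun ij : Fin n × Fin k => ∑ s : Fin n, ∑ t : Fin k,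
    MvPolynomial.C (g s ij.1 * h t ij.2) * MvPolynomial.X (s, t))
    (fun ij => MvPolynomial.IsHomogeneous.sum _ _ _ fun s _ =>
      MvPolynomial.IsHomogeneous.sum _ _ _ fun t _ => MvPolynomial.isHomogeneous_C_mul_X _ _)
  rwa [one_mul] at this

theorem homogeneousComponent_sum {σ : Type*} {s : Finset ℕ} {g : ℕ → MvPolynomial σ ℂ}
    (hg : ∀ k, (g k).IsHomogeneous (3 * k)) {m : ℕ} (hm : m ∈ s) :
    MvPolynomial.homogeneousComponent (3 * m) (∑ k ∈ s, g k) = g m := by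
  rw [map_sum, Finset.sum_eq_single m]
  · rw [MvPolynomial.homogeneousComponent_of_mem (hg m), if_pos rfl]
  · intro k _ hk
    rw [MvPolynomial.homogeneousComponent_of_mem (hg k), if_neg (by omega)]
  · intro h; exact absurd hm h

/-- Eigenvectors of a degree preserving substitution have homogeneous components which are
eigenvectors. -/
theorem subst_eq_smul_of_sum {u : Matrix (Fin n) (Fin n) ℂ} {h : Matrix (Fin 3) (Fin 3) ℂ}
    {s : Finset ℕ} {g : ℕ → P n 3} (hg : ∀ k, (g k).IsHomogeneous (3 * k)) {c : ℂ}
    (hs : subst u h (∑ k ∈ s, g k) = c • ∑ k ∈ s, g k) {m : ℕ} (hm : m ∈ s) :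
    subst u h (g m) = c • g m := by
  have := congrArg (MvPolynomial.homogeneousComponent (3 * m)) hs
  rwa [map_sum, homogeneousComponent_sum (fun k => isHomogeneous_subst u h (hg k)) hm, map_smul,
    homogeneousComponent_sum hg hm] at this

theorem mem_paritySpan (hn : 3 ≤ n) {i : ℕ} {f : P n 3} (hf : f ∈ QU n 3)
    (hS : ∀ τ : Equiv.Perm (Fin 3), symAction n 3 τ f = ((Equiv.Perm.sign τ : ℤ) : ℂ) ^ i • f) :
    f ∈ paritySpan hn i := by
  have hQ : f ∈ ⨆ m : ℕ, Qm n 3 m := hf.1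
  obtain ⟨g, hg, hsum⟩ := (Submodule.mem_iSup_iff_exists_finsupp _ _).1 hQ
  have hhom : ∀ k, (g k).IsHomogeneous (3 * k) := fun k => isHomogeneous_of_mem_Qm (hg k)
  have hU := hf.2
  subst hsum
  refine sum_mem fun m hm => mem_paritySpan_of_mem_Qm hn (fun u hu => ?_) (hg m) (fun τ => ?_)
  · have h1 : subst u.val 1 (∑ k ∈ g.support, g k) = (1 : ℂ) • ∑ k ∈ g.support, g k := by
      rw [one_smul]; exact hU u hu
    have := subst_eq_smul_of_sum hhom h1 hm
    rwa [one_smul] at this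
  · have h1 := hS τ
    -- As a substitution by a permutation matrix, the symmetric group action is covered by the same
    -- homogeneity argument.
    rw [symAction_eq_subst] at h1 ⊢
    exact subst_eq_smul_of_sum hhom h1 hm

end Components

/-! ### Parity form of the spanning sets and conclusion -/

section Generators
variable {n : ℕ} (hn : 3 ≤ n)

/-- If d + e is even, then both exponents are even, or both are odd and a single factor γ₁γ₂ splits
off. -/
theorem Sinv_eq : Sinv hn = {p | ∃ a b c d e : ℕ, (d + e) % 2 = 0 % 2 ∧
    p = α₁ hn ^ a * α₂ hn ^ b * α₃ hn ^ c * γ₁ hn ^ d * γ₂ hn ^ e} := by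
  ext p
  constructor
  · rintro ⟨a, b, c, d, e, f, rfl⟩
    exact ⟨a, b, c, 2 * d + f, 2 * e + f, by omega, by ring⟩
  · rintro ⟨a, b, c, d, e, h, rfl⟩
    rcases Nat.even_or_odd' d with ⟨d', rfl | rfl⟩
    · obtain ⟨e', rfl⟩ : ∃ e', e = 2 * e' := ⟨e / 2, by omega⟩
      exact ⟨a, b, c, d', e', 0, by ring⟩
    · obtain ⟨e', rfl⟩ : ∃ e', e = 2 * e' + 1 := ⟨e / 2, by omega⟩
      exact ⟨a, b, c, d', e', 1, by ring⟩

theorem Ssgn_eq : Ssgn hn =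
    {p | ∃ a b c d e : ℕ,
      p = α₁ hn ^ a * α₂ hn ^ b * α₃ hn ^ c * γ₁ hn ^ (2 * d + 1) * γ₂ hn ^ (2 * e)} ∪
    {p | ∃ a b c d e : ℕ,
      p = α₁ hn ^ a * α₂ hn ^ b * α₃ hn ^ c * γ₁ hn ^ (2 * d) * γ₂ hn ^ (2 * e + 1)} := by
  ext p
  constructor
  · rintro (⟨_, ⟨a, b, c, d, e, f, rfl⟩, rfl⟩ | ⟨_, ⟨a, b, c, d, e, f, rfl⟩, rfl⟩) <;>
      rcases Nat.even_or_odd' f with ⟨f', rfl | rfl⟩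
    · exact Or.inl ⟨a, b, c, d + f', e + f', by ring⟩
    · exact Or.inr ⟨a, b, c, d + f' + 1, e + f', by ring⟩
    · exact Or.inr ⟨a, b, c, d + f', e + f', by ring⟩
    · exact Or.inl ⟨a, b, c, d + f', e + f' + 1, by ring⟩
  · rintro (⟨a, b, c, d, e, rfl⟩ | ⟨a, b, c, d, e, rfl⟩)
    · exact Or.inl ⟨_, ⟨a, b, c, d, e, 0, rfl⟩, by ring⟩
    · exact Or.inr ⟨_, ⟨a, b, c, d, e, 0, rfl⟩, by ring⟩

theorem paritySpan_one_le : paritySpan hn 1 ≤ Submodule.span ℂ (Ssgn hn) := by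
  refine Submodule.span_mono ?_
  rintro p ⟨a, b, c, d, e, h, rfl⟩
  rw [Ssgn_eq]
  rcases Nat.even_or_odd' d with ⟨d', rfl | rfl⟩
  · obtain ⟨e', rfl⟩ : ∃ e', e = 2 * e' + 1 := ⟨e / 2, by omega⟩
    exact Or.inr ⟨a, b, c, d', e', rfl⟩
  · obtain ⟨e', rfl⟩ : ∃ e', e = 2 * e' := ⟨e / 2, by omega⟩
    exact Or.inl ⟨a, b, c, d', e', rfl⟩

theorem α₁_mem_QUinv : α₁ hn ∈ QUinv n 3 := ⟨α₁_mem_QU hn, symAction_α₁ hn⟩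
theorem α₂_mem_QUinv : α₂ hn ∈ QUinv n 3 := ⟨α₂_mem_QU hn, symAction_α₂ hn⟩
theorem α₃_mem_QUinv : α₃ hn ∈ QUinv n 3 := ⟨α₃_mem_QU hn, symAction_α₃ hn⟩
theorem γ₁_mem_QUsgn : γ₁ hn ∈ QUsgn n 3 := ⟨γ₁_mem_QU hn, symAction_γ₁ hn⟩
theorem γ₂_mem_QUsgn : γ₂ hn ∈ QUsgn n 3 := ⟨γ₂_mem_QU hn, symAction_γ₂ hn⟩

theorem mul_mem_QUinv_of_mem_QUsgn {f g : P n 3} (hf : f ∈ QUsgn n 3) (hg : g ∈ QUsgn n 3) :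
    f * g ∈ QUinv n 3 := by
  refine ⟨mul_mem hf.1 hg.1, fun τ => ?_⟩
  rw [map_mul, hf.2, hg.2, smul_mul_smul_comm, sign_cast_sq, one_smul]

theorem mul_mem_QUsgn {f g : P n 3} (hf : f ∈ QUsgn n 3) (hg : g ∈ QUinv n 3) :
    f * g ∈ QUsgn n 3 := by
  refine ⟨mul_mem hf.1 hg.1, fun τ => ?_⟩
  rw [map_mul, hf.2, hg.2, smul_mul_assoc]

/-- The proposed generators of the algebra of invariants. -/
def generators : Set (P n 3) :=
  {α₁ hn, α₂ hn, α₃ hn, γ₁ hn ^ 2, γ₂ hn ^ 2, γ₁ hn * γ₂ hn}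

theorem adjoin_generators_le : Algebra.adjoin ℂ (generators hn) ≤ QUinv n 3 := by
  refine Algebra.adjoin_le ?_
  have h₁ := γ₁_mem_QUsgn hn
  have h₂ := γ₂_mem_QUsgn hn
  rintro p (rfl | rfl | rfl | rfl | rfl | rfl)
  · exact α₁_mem_QUinv hn
  · exact α₂_mem_QUinv hn
  · exact α₃_mem_QUinv hn
  · rw [sq]; exact mul_mem_QUinv_of_mem_QUsgn h₁ h₁
  · rw [sq]; exact mul_mem_QUinv_of_mem_QUsgn h₂ h₂
  · exact mul_mem_QUinv_of_mem_QUsgn h₁ h₂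

theorem Sinv_subset_adjoin : Sinv hn ⊆ Algebra.adjoin ℂ (generators hn) := by
  rintro p ⟨a, b, c, d, e, f, rfl⟩
  have h : ∀ q ∈ generators hn, q ∈ Algebra.adjoin ℂ (generators hn) :=
    fun q hq => Algebra.subset_adjoin hq
  refine mul_mem (mul_mem (mul_mem (mul_mem (mul_mem ?_ ?_) ?_) ?_) ?_) ?_ <;>
    refine pow_mem (h _ ?_) _ <;> simp [generators]

theorem span_Sinv_le : Submodule.span ℂ (Sinv hn) ≤
    Subalgebra.toSubmodule (Algebra.adjoin ℂ (generators hn)) :=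
  Submodule.span_le.2 (Sinv_subset_adjoin hn)

theorem QUinv_le_span : Subalgebra.toSubmodule (QUinv n 3) ≤ Submodule.span ℂ (Sinv hn) := by
  rw [Sinv_eq]
  exact fun f hf => mem_paritySpan hn (i := 0) hf.1 fun τ => by rw [hf.2, pow_zero, one_smul]

theorem QUsgn_eq_span : QUsgn n 3 = Submodule.span ℂ (Ssgn hn) := by
  refine le_antisymm (fun f hf => paritySpan_one_le hn
    (mem_paritySpan hn hf.1 fun τ => by rw [hf.2, pow_one])) (Submodule.span_le.2 ?_)
  rintro p (⟨h, hh, rfl⟩ | ⟨h, hh, rfl⟩)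
  · exact mul_mem_QUsgn (γ₁_mem_QUsgn hn) (adjoin_generators_le hn (Sinv_subset_adjoin hn hh))
  · exact mul_mem_QUsgn (γ₂_mem_QUsgn hn) (adjoin_generators_le hn (Sinv_subset_adjoin hn hh))

end Generators

end Plethysm

end

theorem mainTheorem4 (n : ℕ) (hn : 3 ≤ n) :
    (Subalgebra.toSubmodule (Plethysm.QUinv n 3) = Submodule.span ℂ (Plethysm.Sinv hn) ∧
      Plethysm.QUinv n 3 =
        Algebra.adjoin ℂ
          {Plethysm.α₁ hn, Plethysm.α₂ hn, Plethysm.α₃ hn, Plethysm.γ₁ hn ^ 2,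
            Plethysm.γ₂ hn ^ 2, Plethysm.γ₁ hn * Plethysm.γ₂ hn}) ∧
    (Plethysm.QUsgn n 3 = Submodule.span ℂ (Plethysm.Ssgn hn) ∧
      Plethysm.Ssgn hn =
        {p | ∃ a b c d e : ℕ,
          p = Plethysm.α₁ hn ^ a * Plethysm.α₂ hn ^ b * Plethysm.α₃ hn ^ c *
            Plethysm.γ₁ hn ^ (2 * d + 1) * Plethysm.γ₂ hn ^ (2 * e)} ∪
        {p | ∃ a b c d e : ℕ,
          p = Plethysm.α₁ hn ^ a * Plethysm.α₂ hn ^ b * Plethysm.α₃ hn ^ c *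
            Plethysm.γ₁ hn ^ (2 * d) * Plethysm.γ₂ hn ^ (2 * e + 1)}) := by
  refine ⟨⟨le_antisymm (Plethysm.QUinv_le_span hn) ?_, le_antisymm ?_ ?_⟩,
    Plethysm.QUsgn_eq_span hn, Plethysm.Ssgn_eq hn⟩
  · exact (Plethysm.span_Sinv_le hn).trans (Plethysm.adjoin_generators_le hn)
  · exact (Plethysm.QUinv_le_span hn).trans (Plethysm.span_Sinv_le hn)
  · exact Plethysm.adjoin_generators_le hn
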